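/- Let $(\mathsf X,\mathcal X)$ be a measurable space, $M_0$ a probability measure on $\mathsf X$, $(M_t)_{t\ge1}$ Markov kernels on $\mathsf X$ and $(g_t)_{t\ge0}$ measurable functions $\mathsf X\to\mathbb R$. Assume: (A1) there is a measure $\nu$ on $\mathsf X$ such that $M_0$ has a density $m_0$ with respect to $\nu$ and, for all $t\ge1$ and $x'\in\mathsf X$, $M_t(x',\cdot)$ has density $m_t(x',\cdot)$ with respect to $\nu$ ($m_0$ and, jointly in both variables, $m_t$ being measurable and non-negative); (A2) there is $G_\infty>0$ with $0<g_t(x)\le G_\infty$ for all $t\ge0$, $x\in\mathsf X$; (A3) $m_t(x',x)>0$ for all $t\ge1$, $x,x'\in\mathsf X$; (A4) there is $\sigma_+>0$ with $m_t(x',x)\le\sigma_+$ for all $t\ge1$, $x,x'\in\mathsf X$. Put $Q_{t+1}(x,dy)=g_t(x)M_{t+1}(x,dy)$, $\gamma_0=M_0$, $\gamma_{t+1}=\gamma_tQ_{t+1}$, $\eta_t=\gamma_t/\gamma_t(\mathbf 1)$, $\phi_t(dx)=g_t(x)\eta_t(dx)/\eta_t(g_t)$, and let $\bar Q_{s+1:t}=Q_{s+1}Q_{s+2}\cdots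 Q_t$ for $s<t$, $\bar Q_{t+1:t}=\mathrm{Id}$. For bounded measurable $h:\mathsf X\to\mathbb R$ set $$\sigma^2_{\eta,t}(h)=\sum_{s=0}^t\frac{\gamma_s(\mathbf 1)\,\gamma_s\big((\bar Q_{s+1:t}[h-\eta_t(h)])^2\big)}{\gamma_t(\mathbf 1)^2},\qquad \sigma^2_{\phi,t}(h)=\sum_{s=0}^t\frac{\gamma_s(\mathbf 1)\,\gamma_s\big((\bar Q_{s+1:t}[g_t\{h-\phi_t(h)\}])^2\big)}{\gamma_{t+1}(\mathbf 1)^2}.$$ For each $N$, run the bootstrap particle filter with multinomial resampling: $\xi_0^1,\dots,\xi_0^N$ are i.i.d. with law $M_0$; given all particles up to time $t$ and all ancestor indices up to time $t-1$, the pairs $(A_t^i,\xi_{t+1}^i)$, $1\le i\le N$, are independent, $A_t^i=j$ with probability $W_t^j=g_t(\xi_t^j)/\sum_{\ell=1}^N g_t(\xi_t^\ell)$, and $\xi_{t+1}^i\sim M_{t+1}(\xi_t^{A_t^i},\cdot)$ given $A_t^i$. (The filters for different $N$ may live on different probability spaces.) Let $\eta_t^N(h)=N^{-1}\sum_i h(\xi_t^i)$,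 $\phi_t^N(h)=\sum_iW_t^ih(\xi_t^i)$ and, for $s\ge1$, $$\beta_s(k,\ell)=\frac{g_{s-1}(\xi_{s-1}^\ell)m_s(\xi_{s-1}^\ell,\xi_s^k)}{\sum_{j=1}^N g_{s-1}(\xi_{s-1}^j)m_s(\xi_{s-1}^j,\xi_s^k)}.$$ Given the particles, let the random index trajectories $K^1_{0:t},K^2_{0:t}\in[N]^{t+1}$ have joint law $\Lambda_1(k^1_{0:t})\Lambda_2(k^1_{0:t};k^2_{0:t})$, where $$\Lambda_1(k^1_{0:t})=N^{-1}\prod_{s=1}^t\beta_s(k^1_s,k^1_{s-1}),\qquad \Lambda_2(k^1_{0:t};k^2_{0:t})=N^{-1}\prod_{s=1}^t\big\{\mathbf 1_{k^2_s=k^1_s}W_{s-1}^{k^2_{s-1}}+\mathbf 1_{k^2_s\ne k^1_s}\beta_s(k^2_s,k^2_{s-1})\big\},$$ and let $\mathcal T_t(i,j)$ be the conditional probability, given the particles and $K^1_t=i$, $K^2_t=j$, that $K^1_s\ne K^2_s$ for all $0\le s\le t$. Define the backward-sampling variance estimators $$\widehat\sigma^2_{\eta,t}(h)=\frac{-N^t}{(N-1)^{t+1}}\sum_{i,j=1}^N\mathcal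 T_t(i,j)\{h(\xi_t^i)-\eta_t^N(h)\}\{h(\xi_t^j)-\eta_t^N(h)\},$$ $$\widehat\sigma^2_{\phi,t}(h)=\frac{-N^{t+2}}{(N-1)^{t+1}}\sum_{i,j=1}^NW_t^iW_t^j\,\mathcal T_t(i,j)\{h(\xi_t^i)-\phi_t^N(h)\}\{h(\xi_t^j)-\phi_t^N(h)\}.$$ Then for every $t\ge0$ and every bounded measurable $h:\mathsf X\to\mathbb R$, as $N\to\infty$, $\widehat\sigma^2_{\eta,t}(h)\to\sigma^2_{\eta,t}(h)$ and $\widehat\sigma^2_{\phi,t}(h)\to\sigma^2_{\phi,t}(h)$ in probability. -/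

import Mathlib

open MeasureTheory ProbabilityTheory Filter Topology
open scoped ENNReal BigOperators

noncomputable section

namespace SMCVar

variable {X : Type*} [MeasurableSpace X]

/-- A Feynman-Kac (state space) model on `X`: an initial probability measure `M₀`, Markov kernels
and non-negative measurable potentials. Here `M t` is the transition from time `t` to time `t + 1`
(usually written with the index `t + 1`) and `g t` is the potential at time `t`. -/
structure Model (X : Type*) [MeasurableSpace X] where
  M₀ : Measure X
  M : ℕ → Kernel X X
  g : ℕ → X → ℝ
  prob_M₀ : IsProbabilityMeasure M₀
  markov_M : ∀ t, IsMarkovKernel (M t)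
  measurable_g : ∀ t, Measurable (g t)
  g_nonneg : ∀ t x, 0 ≤ g t x

attribute [instance] Model.prob_M₀ Model.markov_M

/-- `m₀` is a density of the initial law and `m t x` is a density of `M t x`, all with respect to
the same reference measure `ν`; the transition densities are jointly measurable. -/
structure HasDensities (S : Model X) (ν : Measure X) (m₀ : X → ℝ) (m : ℕ → X → X → ℝ) :
    Prop where
  measurable_m₀ : Measurable m₀
  m₀_nonneg : ∀ x, 0 ≤ m₀ x
  M₀_eq : S.M₀ = ν.withDensity (fun x => ENNReal.ofReal (m₀ x))
  measurable_m : ∀ t, Measurable (Function.uncurry (m t))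
  m_nonneg : ∀ t x y, 0 ≤ m t x y
  M_eq : ∀ t x, S.M t x = ν.withDensity (fun y => ENNReal.ofReal (m t x y))

namespace Model

variable (S : Model X)

/-- The unnormalized kernel `Q t (x, dy) = g t x * M t (x, dy)` from time `t` to time `t + 1`. -/
def Q (t : ℕ) : Kernel X X :=
  Kernel.withDensity (S.M t) (fun x _ => ENNReal.ofReal (S.g t x))

/-- The kernel from time `s` to time `t`: the composition of `Q s, …, Q (t - 1)` (which is the
last-coordinate marginal of their tensor product), and the identity if `t ≤ s`. -/
def Qbar (s : ℕ) : ℕ → Kernel X X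
  | 0 => Kernel.id
  | t + 1 => if s ≤ t then S.Q t ∘ₖ Qbar s t else Kernel.id

/-- The unnormalized predictive measures `γ_t`. -/
def gam : ℕ → Measure X
  | 0 => S.M₀
  | t + 1 => (gam t).bind (S.Q t)

/-- The predictive measure `η_t = γ_t / γ_t(1)`. -/
def eta (t : ℕ) : Measure X := (S.gam t Set.univ)⁻¹ • S.gam t

/-- The filtering measure `φ_t(dx) = g_t(x) η_t(dx) / η_t(g_t)`. -/
def phi (t : ℕ) : Measure X :=
  (∫⁻ x, ENNReal.ofReal (S.g t x) ∂(S.eta t))⁻¹ •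
    (S.eta t).withDensity (fun x => ENNReal.ofReal (S.g t x))

/-- The asymptotic variance of the particle approximation of the predictor `η_t(h)`. -/
def sigmaSqEta (t : ℕ) (h : X → ℝ) : ℝ :=
  ∑ s ∈ Finset.range (t + 1),
    (S.gam s).real Set.univ *
      (∫ x, (∫ y, (h y - ∫ z, h z ∂(S.eta t)) ∂(S.Qbar s t x)) ^ 2 ∂(S.gam s)) /
      ((S.gam t).real Set.univ) ^ 2

/-- The asymptotic variance of the particle approximation of the filter `φ_t(h)`. -/
def sigmaSqPhi (t : ℕ) (h : X → ℝ) : ℝ :=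
  ∑ s ∈ Finset.range (t + 1),
    (S.gam s).real Set.univ *
      (∫ x, (∫ y, S.g t y * (h y - ∫ z, h z ∂(S.phi t)) ∂(S.Qbar s t x)) ^ 2 ∂(S.gam s)) /
      ((S.gam (t + 1)).real Set.univ) ^ 2

/-! ### Statistics of a particle cloud

`x s i` is the position of the `i`-th of `N` particles at time `s`. -/

variable {N : ℕ}

/-- Normalized weight of the `i`-th particle at time `t`. -/
def weight (x : ℕ → Fin N → X) (t : ℕ) (i : Fin N) : ℝ :=
  S.g t (x t i) / ∑ j, S.g t (x t j)

/-- `η_t^N(h)`. -/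
def etaN (_S : Model X) (x : ℕ → Fin N → X) (t : ℕ) (h : X → ℝ) : ℝ :=
  (N : ℝ)⁻¹ * ∑ i, h (x t i)

/-- `φ_t^N(h)`. -/
def phiN (x : ℕ → Fin N → X) (t : ℕ) (h : X → ℝ) : ℝ :=
  ∑ i, S.weight x t i * h (x t i)

/-- Backward-sampling weight: probability of moving from particle `k` at time `s + 1` to
particle `l` at time `s`. -/
def betaBS (m : ℕ → X → X → ℝ) (x : ℕ → Fin N → X) (s : ℕ) (k l : Fin N) : ℝ :=
  S.g s (x s l) * m s (x s l) (x (s + 1) k) /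
    ∑ j, S.g s (x s j) * m s (x s j) (x (s + 1) k)

/-- Law of the first backward index trajectory `K¹_{0:t}`, given the particles. -/
def Lambda₁ (m : ℕ → X → X → ℝ) (x : ℕ → Fin N → X) (t : ℕ) (k : Fin (t + 1) → Fin N) : ℝ :=
  (N : ℝ)⁻¹ * ∏ s : Fin t, S.betaBS m x s (k s.succ) (k s.castSucc)

/-- Law of the second backward index trajectory `K²_{0:t}`, given the particles and the first
trajectory. -/
def Lambda₂ (m : ℕ → X → X → ℝ) (x : ℕ → Fin N → X) (t : ℕ) (k₁ k₂ : Fin (t + 1) → Fin N) : ℝ :=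
  (N : ℝ)⁻¹ * ∏ s : Fin t,
    if k₂ s.succ = k₁ s.succ then S.weight x s (k₂ s.castSucc)
    else S.betaBS m x s (k₂ s.succ) (k₂ s.castSucc)

/-- Coalescence function: the trajectories meet exactly at the times `s` with `b s = 1`. -/
def coal {t : ℕ} (b : Fin (t + 1) → Fin 2) (k₁ k₂ : Fin (t + 1) → Fin N) : ℝ :=
  if ∀ s, (k₁ s = k₂ s ↔ b s = 1) then 1 else 0

/-- Conditional expectation of the coalescence function given the particles and the terminal
indices `K¹_t = k`, `K²_t = l`, under the (discrete) backward sampling law of the pair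
`(K¹_{0:t}, K²_{0:t})`. -/
def T (m : ℕ → X → X → ℝ) (x : ℕ → Fin N → X) (t : ℕ) (b : Fin (t + 1) → Fin 2)
    (k l : Fin N) : ℝ :=
  (∑ k₁ : Fin (t + 1) → Fin N, ∑ k₂ : Fin (t + 1) → Fin N,
      if k₁ (Fin.last t) = k ∧ k₂ (Fin.last t) = l then
        S.Lambda₁ m x t k₁ * S.Lambda₂ m x t k₁ k₂ * coal b k₁ k₂ else 0) /
    (∑ k₁ : Fin (t + 1) → Fin N, ∑ k₂ : Fin (t + 1) → Fin N,
      if k₁ (Fin.last t) = k ∧ k₂ (Fin.last t) = l then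
        S.Lambda₁ m x t k₁ * S.Lambda₂ m x t k₁ k₂ else 0)

/-- Backward-sampling estimator of the asymptotic variance of the predictor. -/
def estEta (m : ℕ → X → X → ℝ) (x : ℕ → Fin N → X) (t : ℕ) (h : X → ℝ) : ℝ :=
  -(N : ℝ) ^ t / ((N : ℝ) - 1) ^ (t + 1) *
    ∑ i, ∑ j, S.T m x t (fun _ => 0) i j *
      (h (x t i) - S.etaN x t h) * (h (x t j) - S.etaN x t h)

/-- Backward-sampling estimator of the asymptotic variance of the filter. -/
def estPhi (m : ℕ → X → X → ℝ) (x : ℕ → Fin N → X) (t : ℕ) (h : X → ℝ) : ℝ :=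
  -(N : ℝ) ^ (t + 2) / ((N : ℝ) - 1) ^ (t + 1) *
    ∑ i, ∑ j, S.weight x t i * S.weight x t j * S.T m x t (fun _ => 0) i j *
      (h (x t i) - S.phiN x t h) * (h (x t j) - S.phiN x t h)

/-! ### The bootstrap particle filter -/

variable {Ω : Type*} [MeasurableSpace Ω]

/-- The σ-field generated by the particles up to time `t` and the ancestor indices up to
time `t - 1`. -/
@[reducible]
def history (ξ : ℕ → Fin N → Ω → X) (A : ℕ → Fin N → Ω → Fin N) (t : ℕ) : MeasurableSpace Ω :=
  (⨆ (s : ℕ) (_ : s ≤ t) (i : Fin N), MeasurableSpace.comap (ξ s i) inferInstance) ⊔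
    (⨆ (s : ℕ) (_ : s < t) (i : Fin N), MeasurableSpace.comap (A s i) inferInstance)

/-- `ξ` (particles) and `A` (ancestor indices) form a bootstrap particle filter with `N` particles
and multinomial resampling for the model `S`: the initial particles are i.i.d. with law `M₀`;
given the history up to time `t`, the pairs `(A t i, ξ (t + 1) i)`, `i < N`, are independent, the
index `A t i` is drawn with probabilities given by the normalized weights at time `t`, and
`ξ (t + 1) i` is then drawn from `M t` started at the selected particle. -/
structure IsBootstrapFilter (P : Measure Ω) (ξ : ℕ → Fin N → Ω → X)
    (A : ℕ → Fin N → Ω → Fin N) : Prop where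
  measurable_ξ : ∀ t i, Measurable (ξ t i)
  measurable_A : ∀ t i, Measurable (A t i)
  init : P.map (fun ω i => ξ 0 i ω) = Measure.pi (fun _ : Fin N => S.M₀)
  step : ∀ (t : ℕ) (a : Fin N → Fin N) (B : Fin N → Set X), (∀ i, MeasurableSet (B i)) →
    P⟦{ω | ∀ i, A t i ω = a i ∧ ξ (t + 1) i ω ∈ B i} | history ξ A t⟧ =ᵐ[P]
      fun ω => ∏ i, S.weight (fun s j => ξ s j ω) t (a i) * (S.M t (ξ t (a i) ω)).real (B i)

end Model

/-- Convergence in probability to a constant `c`, as `N → ∞`, of real random variables `V N`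
which may live on different probability spaces. -/
def TendstoInProbability {Ω : ℕ → Type*} [∀ N, MeasurableSpace (Ω N)]
    (P : ∀ N, Measure (Ω N)) (V : ∀ N, Ω N → ℝ) (c : ℝ) : Prop :=
  ∀ ε : ℝ, 0 < ε → Tendsto (fun N => P N {ω | ε ≤ |V N ω - c|}) atTop (𝓝 0)

end SMCVar

end

noncomputable section

namespace SMCVar

/-! A conditionally non-meeting pair of index trajectories never uses the resampling branch of the
second backward law, so `T` for the zero coalescence pattern is one minus `meet`, the probability
that two independent backward trajectories have met (`T_eq_one_sub_meet`). The centred values sum to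
zero, so the constant one drops out of the double sum. Each estimator is then `(N/(N-1))^(t+1)`
times `quadV` of a centred function, divided by a squared normalizing constant.

The form `quadV` obeys, up to a small error, the recursion of the asymptotic variance. Conditionally
on the past the next particles are i.i.d. from a mixture law (`lintegral_next`), and by Bayes'
formula the backward weight is the conditional probability of the ancestor given the child
(`integral_backW_mul`). The diagonal pairs of `quadV` at time `t + 1` therefore give the empirical
mean of `f ^ 2`, and the off-diagonal pairs form a U-statistic with conditional mean `(1 - 1/N)`
times `quadV` of `opQ t f` at time `t`. The recursion `asymV_succ` has the same two terms.

The error is controlled in mean square. Covariances of pairs of indices without a common element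
vanish, and the remaining ones are bounded by the squared row sums of `meet`
(`integral_sq_ustat_sub_le`). The mean of these, `rowR`, is bounded uniformly in `N`
(`lintegral_rowR_le`), so the squared error is `O(1/N)`. The powers of `normC` in `quadV` and `rowR`
cancel the denominators of the normalized weights, so no lower bound on the potentials is needed.
The empirical centring is finally replaced by its limit in `tendsto_quadV_centered`. -/

/-- Bounded measurable real functions. -/
def BddMeas {α : Type*} [MeasurableSpace α] (f : α → ℝ) : Prop :=
  Measurable f ∧ ∃ C : ℝ, ∀ x, |f x| ≤ C

/-! ### Closure properties of bounded measurable functions. -/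

namespace BddMeas

variable {α β : Type*} [MeasurableSpace α] [MeasurableSpace β] {f g : α → ℝ}

lemma const (c : ℝ) : BddMeas (fun _ : α => c) := ⟨measurable_const, |c|, fun _ => le_rfl⟩

lemma add (hf : BddMeas f) (hg : BddMeas g) : BddMeas (fun x => f x + g x) := by
  obtain ⟨hf, C, hC⟩ := hf
  obtain ⟨hg, D, hD⟩ := hg
  exact ⟨hf.add hg, C + D, fun x => (abs_add_le _ _).trans (add_le_add (hC x) (hD x))⟩

lemma mul (hf : BddMeas f) (hg : BddMeas g) : BddMeas (fun x => f x * g x) := by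
  obtain ⟨hf, C, hC⟩ := hf
  obtain ⟨hg, D, hD⟩ := hg
  refine ⟨hf.mul hg, C * D, fun x => ?_⟩
  rw [abs_mul]
  exact mul_le_mul (hC x) (hD x) (abs_nonneg _) ((abs_nonneg _).trans (hC x))

lemma sub (hf : BddMeas f) (hg : BddMeas g) : BddMeas (fun x => f x - g x) := by
  simpa [sub_eq_add_neg] using hf.add ((const (-1)).mul hg)

lemma pow (hf : BddMeas f) (n : ℕ) : BddMeas (fun x => f x ^ n) := by
  induction n with
  | zero => simpa using const (α := α) 1
  | succ n ih => simpa [pow_succ] using ih.mul hf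

lemma comp (hf : BddMeas f) {φ : β → α} (hφ : Measurable φ) : BddMeas (fun x => f (φ x)) :=
  ⟨hf.1.comp hφ, hf.2.imp fun _ hC _ => hC _⟩

lemma sum {ι : Type*} (s : Finset ι) {F : ι → α → ℝ} (hF : ∀ i ∈ s, BddMeas (F i)) :
    BddMeas (fun x => ∑ i ∈ s, F i x) := by
  classical
  induction s using Finset.induction_on with
  | empty => simpa using const (α := α) 0
  | insert i s hi ih =>
    simp only [Finset.sum_insert hi]
    exact (hF i (Finset.mem_insert_self i s)).add
      (ih fun j hj => hF j (Finset.mem_insert_of_mem hj))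

lemma ite {p : Prop} [Decidable p] (hf : BddMeas f) (hg : BddMeas g) :
    BddMeas (fun x => if p then f x else g x) := by
  split_ifs
  · exact hf
  · exact hg

lemma integrable (hf : BddMeas f) (μ : Measure α) [IsFiniteMeasure μ] : Integrable f μ := by
  obtain ⟨hf, C, hC⟩ := hf
  exact Integrable.of_bound hf.aestronglyMeasurable C (ae_of_all _ hC)

lemma abs_integral_le {C : ℝ} (hC : ∀ x, |f x| ≤ C) (μ : Measure α) [IsProbabilityMeasure μ] :
    |∫ x, f x ∂μ| ≤ C := by
  simpa using norm_integral_le_of_norm_le_const (μ := μ) (f := f) (ae_of_all _ hC)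

end BddMeas

/-! ### Moments of products and means of i.i.d. samples. -/

section Iid

variable {X : Type*} [MeasurableSpace X] (μ : Measure X) [IsProbabilityMeasure μ]
  {ι : Type*} [Fintype ι]

lemma iIndepFun_eval_pi : iIndepFun (fun (i : ι) (y : ι → X) => y i) (Measure.pi fun _ => μ) :=
  iIndepFun_pi (μ := fun _ : ι => μ) (X := fun _ x => x) fun _ => aemeasurable_id

lemma integral_pi_eval (i : ι) {φ : X → ℝ} (hφ : Measurable φ) :
    ∫ y, φ (y i) ∂(Measure.pi fun _ : ι => μ) = ∫ x, φ x ∂μ := by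
  have h := (measurePreserving_eval (fun _ : ι => μ) i)
  have h2 := integral_map (μ := Measure.pi fun _ : ι => μ) h.measurable.aemeasurable
    hφ.aestronglyMeasurable
  rw [h.map_eq] at h2
  exact h2.symm

lemma integral_pi_mul {i j : ι} (hij : i ≠ j) {φ ψ : X → ℝ} (hφ : Measurable φ)
    (hψ : Measurable ψ) :
    ∫ y, φ (y i) * ψ (y j) ∂(Measure.pi fun _ : ι => μ) = (∫ x, φ x ∂μ) * ∫ x, ψ x ∂μ := by
  have h := ((iIndepFun_eval_pi μ).indepFun hij).comp hφ hψ
  rw [← integral_pi_eval μ i hφ, ← integral_pi_eval μ j hψ]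
  exact h.integral_fun_mul_eq_mul_integral
    (hφ.comp (measurable_pi_apply i)).aestronglyMeasurable
    (hψ.comp (measurable_pi_apply j)).aestronglyMeasurable

lemma integral_pi_mul_mul {i j l : ι} (hij : i ≠ j) (hil : i ≠ l) (hjl : j ≠ l) {φ ψ χ : X → ℝ}
    (hφ : Measurable φ) (hψ : Measurable ψ) (hχ : Measurable χ) :
    ∫ y, φ (y i) * (ψ (y j) * χ (y l)) ∂(Measure.pi fun _ : ι => μ) =
      (∫ x, φ x ∂μ) * ((∫ x, ψ x ∂μ) * ∫ x, χ x ∂μ) := by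
  have h := ((iIndepFun_eval_pi μ).indepFun_prodMk (fun i => measurable_pi_apply i) j l i
    hij.symm hil.symm).symm.comp hφ
      (φ := φ) (ψ := fun p : X × X => ψ p.1 * χ p.2) (by fun_prop)
  rw [← integral_pi_eval μ i hφ, ← integral_pi_mul μ hjl hψ hχ]
  exact h.integral_fun_mul_eq_mul_integral
    (hφ.comp (measurable_pi_apply i)).aestronglyMeasurable
    (by fun_prop : Measurable fun y : ι → X => ψ (y j) * χ (y l)).aestronglyMeasurable

lemma integral_pi_pair_mul_pair {i j k l : ι} (hik : i ≠ k) (hil : i ≠ l) (hjk : j ≠ k)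
    (hjl : j ≠ l) {φ ψ : X × X → ℝ} (hφ : Measurable φ) (hψ : Measurable ψ) :
    ∫ y, φ (y i, y j) * ψ (y k, y l) ∂(Measure.pi fun _ : ι => μ) =
      (∫ y, φ (y i, y j) ∂(Measure.pi fun _ : ι => μ)) *
        ∫ y, ψ (y k, y l) ∂(Measure.pi fun _ : ι => μ) := by
  have h := ((iIndepFun_eval_pi μ).indepFun_prodMk_prodMk (fun i => measurable_pi_apply i) i j k l
    hik hil hjk hjl).comp hφ hψ
  exact h.integral_fun_mul_eq_mul_integral
    (by fun_prop : Measurable fun y : ι → X => φ (y i, y j)).aestronglyMeasurable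
    (by fun_prop : Measurable fun y : ι → X => ψ (y k, y l)).aestronglyMeasurable

/-- After expanding the square, independence kills the off-diagonal covariances; each of the `N`
diagonal terms is a variance, at most the second moment and so at most `K ^ 2`. -/
lemma integral_sq_mean_sub_le {N : ℕ} (hN : 1 ≤ N) {f : X → ℝ} (hf : Measurable f) {K : ℝ}
    (hK : ∀ x, |f x| ≤ K) :
    ∫ y, ((N : ℝ)⁻¹ * ∑ i, f (y i) - ∫ x, f x ∂μ) ^ 2 ∂(Measure.pi fun _ : Fin N => μ) ≤
      K ^ 2 / N := by
  have hfB : BddMeas f := ⟨hf, K, hK⟩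
  set a := ∫ x, f x ∂μ with ha
  have hN0 : (N : ℝ) ≠ 0 := by positivity
  have hE : ∀ i : Fin N, BddMeas fun y : Fin N → X => f (y i) - a := fun i =>
    (hfB.comp (measurable_pi_apply i)).sub (BddMeas.const a)
  have h1 : ∀ y : Fin N → X, ((N : ℝ)⁻¹ * ∑ i, f (y i) - a) ^ 2 =
      (N : ℝ)⁻¹ ^ 2 * ∑ i, ∑ j, (f (y i) - a) * (f (y j) - a) := by
    intro y
    rw [← Finset.sum_mul_sum, Finset.sum_sub_distrib, ← sq, ← mul_pow]
    simp [mul_sub, hN0]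
  simp_rw [h1]
  rw [integral_const_mul, integral_finsetSum _ fun i _ =>
    (BddMeas.sum _ fun j _ => (hE i).mul (hE j)).integrable _]
  have h2 : ∀ i, ∫ y, ∑ j, (f (y i) - a) * (f (y j) - a) ∂(Measure.pi fun _ : Fin N => μ) ≤
      K ^ 2 := by
    intro i
    rw [integral_finsetSum _ fun j _ => ((hE i).mul (hE j)).integrable _,
      Finset.sum_eq_single i]
    · have : ∫ y, (f (y i) - a) * (f (y i) - a) ∂(Measure.pi fun _ : Fin N => μ) =
          ∫ x, (f x - a) * (f x - a) ∂μ :=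
        integral_pi_eval μ i (φ := fun x => (f x - a) * (f x - a)) (by fun_prop)
      rw [this]
      have h3 : ∀ x, (f x - a) * (f x - a) = f x ^ 2 - 2 * a * f x + a ^ 2 := fun x => by ring
      simp_rw [h3]
      rw [integral_add (((hfB.pow 2).sub ((BddMeas.const _).mul hfB)).integrable _)
        (integrable_const _), integral_sub ((hfB.pow 2).integrable _)
        (((BddMeas.const _).mul hfB).integrable _), integral_const_mul, ← ha]
      have h4 : ∫ x, f x ^ 2 ∂μ ≤ K ^ 2 := by
        refine (le_abs_self _).trans (BddMeas.abs_integral_le (fun x => ?_) μ)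
        rw [abs_pow]
        exact pow_le_pow_left₀ (abs_nonneg _) (hK x) 2
      simp only [integral_const, probReal_univ, smul_eq_mul]
      nlinarith [sq_nonneg a]
    · intro j _ hji
      rw [integral_pi_mul μ hji.symm (φ := fun x => f x - a) (ψ := fun x => f x - a)
        (by fun_prop) (by fun_prop), integral_sub (hfB.integrable _) (integrable_const _)]
      simp [ha]
    · simp
  calc _ ≤ (N : ℝ)⁻¹ ^ 2 * ∑ i : Fin N, K ^ 2 := by gcongr with i; exact h2 i
    _ = K ^ 2 / N := by simp; field_simp

end Iid

/-! ### Variance of U-statistics whose kernel is a mixture over random labels. -/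

section UStat

set_option linter.unusedSectionVars false

variable {X : Type*} [MeasurableSpace X] (μ : Measure X) [IsProbabilityMeasure μ]
  {N : ℕ} (b : Fin N → X → ℝ) (E : Fin N → Fin N → ℝ)

/-- The matrix `E` averaged over a pair of independent labels drawn from `b`. -/
def mix (y y' : X) : ℝ := ∑ k, ∑ l, b k y * b l y' * E k l

variable {b E}

lemma mix_symm (hE : ∀ k l, E k l = E l k) (y y' : X) : mix b E y y' = mix b E y' y := by
  unfold mix
  rw [Finset.sum_comm]
  refine Finset.sum_congr rfl fun k _ => Finset.sum_congr rfl fun l _ => ?_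
  rw [hE l k]; ring

lemma mix_nonneg (hb0 : ∀ k x, 0 ≤ b k x) (hE0 : ∀ k l, 0 ≤ E k l) (y y' : X) :
    0 ≤ mix b E y y' :=
  Finset.sum_nonneg fun k _ => Finset.sum_nonneg fun l _ =>
    mul_nonneg (mul_nonneg (hb0 k y) (hb0 l y')) (hE0 k l)

lemma mix_le_one (hb0 : ∀ k x, 0 ≤ b k x) (hb1 : ∀ x, ∑ k, b k x = 1) (hE1 : ∀ k l, E k l ≤ 1)
    (y y' : X) : mix b E y y' ≤ 1 := by
  calc mix b E y y' ≤ ∑ k, ∑ l, b k y * b l y' * 1 := by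
        unfold mix
        gcongr with k _ l _
        · exact mul_nonneg (hb0 k y) (hb0 l y')
        · exact hE1 k l
    _ = 1 := by simp_rw [mul_one]; rw [← Finset.sum_mul_sum, hb1, hb1, one_mul]

lemma le_one_of_sum_eq_one (hb0 : ∀ k x, 0 ≤ b k x) (hb1 : ∀ x, ∑ k, b k x = 1) (k : Fin N)
    (x : X) : |b k x| ≤ 1 := by
  rw [abs_of_nonneg (hb0 k x), ← hb1 x]
  exact Finset.single_le_sum (f := fun k => b k x) (fun k _ => hb0 k x) (Finset.mem_univ k)

lemma bddMeas_mix (hb : ∀ k, BddMeas (b k)) :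
    BddMeas fun p : X × X => mix b E p.1 p.2 :=
  BddMeas.sum _ fun k _ => BddMeas.sum _ fun l _ =>
    (((hb k).comp measurable_fst).mul ((hb l).comp measurable_snd)).mul (BddMeas.const _)

lemma integral_mix_mul_mul (hb : ∀ k, BddMeas (b k)) {f : X → ℝ} (hf : BddMeas f) {i j : Fin N}
    (hij : i ≠ j) :
    ∫ y, mix b E (y i) (y j) * (f (y i) * f (y j)) ∂(Measure.pi fun _ : Fin N => μ) =
      ∑ k, ∑ l, (∫ x, b k x * f x ∂μ) * (∫ x, b l x * f x ∂μ) * E k l := by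
  have hF : ∀ k (i : Fin N), BddMeas fun y : Fin N → X => b k (y i) * f (y i) := fun k i =>
    ((hb k).mul hf).comp (measurable_pi_apply i)
  have h1 : ∀ y : Fin N → X, mix b E (y i) (y j) * (f (y i) * f (y j)) =
      ∑ k, ∑ l, (b k (y i) * f (y i)) * (b l (y j) * f (y j)) * E k l := by
    intro y
    simp only [mix, Finset.sum_mul]
    refine Finset.sum_congr rfl fun k _ => Finset.sum_congr rfl fun l _ => by ring
  simp_rw [h1]
  rw [integral_finsetSum _ fun k _ => (BddMeas.sum _ fun l _ =>
    ((hF k i).mul (hF l j)).mul (BddMeas.const _)).integrable _]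
  refine Finset.sum_congr rfl fun k _ => ?_
  rw [integral_finsetSum _ fun l _ =>
    (((hF k i).mul (hF l j)).mul (BddMeas.const _)).integrable _]
  refine Finset.sum_congr rfl fun l _ => ?_
  rw [integral_mul_const, integral_pi_mul μ hij (φ := fun x => b k x * f x)
    (ψ := fun x => b l x * f x) ((hb k).mul hf).1 ((hb l).mul hf).1]

lemma integral_mix (hb : ∀ k, BddMeas (b k)) {i j : Fin N} (hij : i ≠ j) :
    ∫ y, mix b E (y i) (y j) ∂(Measure.pi fun _ : Fin N => μ) =
      ∑ k, ∑ l, (∫ x, b k x ∂μ) * (∫ x, b l x ∂μ) * E k l := by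
  simpa using integral_mix_mul_mul μ (E := E) hb (BddMeas.const 1) hij

/-- The two factors share only the sample point `y i`. Integrating out the other two leaves the
integral of `(∑ k, b k x * c k) ^ 2`, with `c k` the mean of row `k` of `E`. As `b` is a probability
vector in `k`, Cauchy–Schwarz moves the square inside the sum. -/
lemma integral_mix_mul_mix_le (hb : ∀ k, BddMeas (b k)) (hb0 : ∀ k x, 0 ≤ b k x)
    (hb1 : ∀ x, ∑ k, b k x = 1) {i j j' : Fin N} (hij : i ≠ j) (hij' : i ≠ j') (hjj' : j ≠ j') :
    ∫ y, mix b E (y i) (y j) * mix b E (y i) (y j') ∂(Measure.pi fun _ : Fin N => μ) ≤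
      ∑ k, (∫ x, b k x ∂μ) * (∑ l, (∫ x, b l x ∂μ) * E k l) ^ 2 := by
  set q : Fin N → X → ℝ := fun k x => ∑ l, b l x * E k l with hq
  have hqB : ∀ k, BddMeas (q k) := fun k => BddMeas.sum _ fun l _ => (hb l).mul (BddMeas.const _)
  have hqi : ∀ k, ∫ x, q k x ∂μ = ∑ l, (∫ x, b l x ∂μ) * E k l := by
    intro k
    rw [hq, integral_finsetSum _ fun l _ => ((hb l).mul (BddMeas.const _)).integrable _]
    simp_rw [integral_mul_const]
  have hev : ∀ (φ : X → ℝ) (i : Fin N), BddMeas φ → BddMeas fun y : Fin N → X => φ (y i) :=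
    fun φ i hφ => hφ.comp (measurable_pi_apply i)
  have h1 : ∀ y : Fin N → X, mix b E (y i) (y j) * mix b E (y i) (y j') =
      ∑ k, ∑ k', (b k (y i) * b k' (y i)) * (q k (y j) * q k' (y j')) := by
    intro y
    have : ∀ j, mix b E (y i) (y j) = ∑ k, b k (y i) * q k (y j) := by
      intro j
      simp only [mix, hq, Finset.mul_sum, mul_assoc]
    rw [this, this, Finset.sum_mul_sum]
    refine Finset.sum_congr rfl fun k _ => Finset.sum_congr rfl fun l _ => by ring
  simp_rw [h1]
  have hI : ∀ k k', BddMeas fun y : Fin N → X =>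
      (b k (y i) * b k' (y i)) * (q k (y j) * q k' (y j')) := fun k k' =>
    ((hev _ i (hb k)).mul (hev _ i (hb k'))).mul ((hev _ j (hqB k)).mul (hev _ j' (hqB k')))
  have h2 : ∫ y, ∑ k, ∑ k', (b k (y i) * b k' (y i)) * (q k (y j) * q k' (y j'))
      ∂(Measure.pi fun _ : Fin N => μ) =
      ∫ x, ∑ k, ∑ k', (b k x * b k' x) * ((∫ x, q k x ∂μ) * ∫ x, q k' x ∂μ) ∂μ := by
    rw [integral_finsetSum _ fun k _ => (BddMeas.sum _ fun k' _ => hI k k').integrable _,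
      integral_finsetSum _ fun k _ => (BddMeas.sum _ fun k' _ =>
        ((hb k).mul (hb k')).mul (BddMeas.const _)).integrable _]
    refine Finset.sum_congr rfl fun k _ => ?_
    rw [integral_finsetSum _ fun k' _ => (hI k k').integrable _,
      integral_finsetSum _ fun k' _ => (((hb k).mul (hb k')).mul (BddMeas.const _)).integrable _]
    refine Finset.sum_congr rfl fun k' _ => ?_
    rw [integral_mul_const, integral_pi_mul_mul μ hij hij' hjj' (φ := fun x => b k x * b k' x)
      ((hb k).mul (hb k')).1 (hqB k).1 (hqB k').1]
  rw [h2]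
  simp_rw [← hqi]
  set c : Fin N → ℝ := fun k => ∫ x, q k x ∂μ
  calc ∫ x, ∑ k, ∑ k', (b k x * b k' x) * (c k * c k') ∂μ
      ≤ ∫ x, ∑ k, b k x * c k ^ 2 ∂μ := by
        refine integral_mono ((BddMeas.sum _ fun k _ => BddMeas.sum _ fun k' _ =>
          ((hb k).mul (hb k')).mul (BddMeas.const _)).integrable _)
          ((BddMeas.sum _ fun k _ => (hb k).mul (BddMeas.const _)).integrable _) fun x => ?_
        have h3 : ∑ k, ∑ k', (b k x * b k' x) * (c k * c k') = (∑ k, b k x * c k) ^ 2 := by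
          rw [sq, Finset.sum_mul_sum]
          refine Finset.sum_congr rfl fun k _ => Finset.sum_congr rfl fun l _ => by ring
        have h4 := Finset.sum_sq_le_sum_mul_sum_of_sq_le_mul Finset.univ
          (r := fun k => b k x * c k) (f := fun k => b k x) (g := fun k => b k x * c k ^ 2)
          (fun k _ => hb0 k x) (fun k _ => mul_nonneg (hb0 k x) (sq_nonneg _))
          (fun k _ => le_of_eq (by ring))
        rw [hb1, one_mul] at h4
        exact h3.le.trans h4
    _ = ∑ k, (∫ x, b k x ∂μ) * c k ^ 2 := by
        rw [integral_finsetSum _ fun k _ => ((hb k).mul (BddMeas.const _)).integrable _]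
        simp_rw [integral_mul_const]

/-- `mix` evaluated at two distinct sample points, and zero on the diagonal. -/
def offMix (b : Fin N → X → ℝ) (E : Fin N → Fin N → ℝ) (y : Fin N → X) (i j : Fin N) : ℝ :=
  if i = j then 0 else mix b E (y i) (y j)

lemma bddMeas_offMix (hb : ∀ k, BddMeas (b k)) (i j : Fin N) :
    BddMeas fun y : Fin N → X => offMix b E y i j :=
  BddMeas.ite (BddMeas.const 0) ((bddMeas_mix hb).comp (φ := fun y : Fin N → X => (y i, y j))
    (by fun_prop))

lemma offMix_nonneg (hb0 : ∀ k x, 0 ≤ b k x) (hE0 : ∀ k l, 0 ≤ E k l) (y : Fin N → X)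
    (i j : Fin N) : 0 ≤ offMix b E y i j := by
  unfold offMix
  split_ifs
  · exact le_rfl
  · exact mix_nonneg hb0 hE0 _ _

lemma offMix_symm (hE : ∀ k l, E k l = E l k) (y : Fin N → X) (i j : Fin N) :
    offMix b E y i j = offMix b E y j i := by
  simp only [offMix, eq_comm (a := i), mix_symm hE (y i)]

/-- In the expansion of a squared row sum, the `N` terms with `j = j'` are linearized by `mix ≤ 1`,
while the terms with `j ≠ j'` fall under `integral_mix_mul_mix_le`. The constant `1` inside the
square stands for the diagonal entry of the next meeting matrix. -/
lemma integral_sum_sq_row_le (hb : ∀ k, BddMeas (b k)) (hb0 : ∀ k x, 0 ≤ b k x)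
    (hb1 : ∀ x, ∑ k, b k x = 1) (hE0 : ∀ k l, 0 ≤ E k l) (hE1 : ∀ k l, E k l ≤ 1) :
    ∫ y, ∑ i, (1 + ∑ j, offMix b E y i j) ^ 2 ∂(Measure.pi fun _ : Fin N => μ) ≤
      2 * N + 2 * N ^ 2 * (∑ k, ∑ l, (∫ x, b k x ∂μ) * (∫ x, b l x ∂μ) * E k l) +
        2 * N ^ 3 * ∑ k, (∫ x, b k x ∂μ) * (∑ l, (∫ x, b l x ∂μ) * E k l) ^ 2 := by
  set θ := ∑ k, ∑ l, (∫ x, b k x ∂μ) * (∫ x, b l x ∂μ) * E k l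
  set ρ := ∑ k, (∫ x, b k x ∂μ) * (∑ l, (∫ x, b l x ∂μ) * E k l) ^ 2
  have hw : ∀ k, 0 ≤ ∫ x, b k x ∂μ := fun k => integral_nonneg (hb0 k)
  have hθ : 0 ≤ θ := Finset.sum_nonneg fun k _ => Finset.sum_nonneg fun l _ =>
    mul_nonneg (mul_nonneg (hw k) (hw l)) (hE0 k l)
  have hρ : 0 ≤ ρ := Finset.sum_nonneg fun k _ => mul_nonneg (hw k) (sq_nonneg _)
  have hB := fun i j => bddMeas_offMix (E := E) hb i j
  have hRB : ∀ i, BddMeas fun y : Fin N → X => (1 + ∑ j, offMix b E y i j) ^ 2 := fun i =>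
    ((BddMeas.const 1).add (BddMeas.sum _ fun j _ => hB i j)).pow 2
  have hpair : ∀ i j j', ∫ y, offMix b E y i j * offMix b E y i j'
      ∂(Measure.pi fun _ : Fin N => μ) ≤ (if j = j' then θ else 0) + ρ := by
    intro i j j'
    by_cases hij : i = j
    · simp only [offMix, hij, if_true, zero_mul, integral_zero]
      split_ifs <;> positivity
    by_cases hij' : i = j'
    · simp only [offMix, hij', if_true, mul_zero, integral_zero]
      split_ifs <;> positivity
    simp only [offMix, if_neg hij, if_neg hij']
    by_cases hjj' : j = j'
    · subst hjj'
      rw [if_pos rfl]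
      refine le_add_of_le_of_nonneg ?_ hρ
      rw [show θ = _ from (integral_mix μ (E := E) hb hij).symm]
      have hm : BddMeas fun y : Fin N → X => mix b E (y i) (y j) :=
        (bddMeas_mix hb).comp (φ := fun y : Fin N → X => (y i, y j)) (by fun_prop)
      refine integral_mono ((hm.mul hm).integrable _) (hm.integrable _) fun y => ?_
      exact mul_le_of_le_one_left (mix_nonneg hb0 hE0 _ _) (mix_le_one hb0 hb1 hE1 _ _)
    · rw [if_neg hjj', zero_add]
      exact integral_mix_mul_mix_le μ hb hb0 hb1 hij hij' hjj'
  have hrow : ∀ i, ∫ y, (1 + ∑ j, offMix b E y i j) ^ 2 ∂(Measure.pi fun _ : Fin N => μ) ≤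
      2 + 2 * (N * θ + N ^ 2 * ρ) := by
    intro i
    calc _ ≤ ∫ y, (2 + 2 * ∑ j, ∑ j', offMix b E y i j * offMix b E y i j')
          ∂(Measure.pi fun _ : Fin N => μ) := by
          refine integral_mono ((hRB i).integrable _) (((BddMeas.const 2).add
            ((BddMeas.const 2).mul (BddMeas.sum _ fun j _ => BddMeas.sum _ fun j' _ =>
              (hB i j).mul (hB i j')))).integrable _) fun y => ?_
          simp only
          rw [← Finset.sum_mul_sum]
          -- This is `(1 + r)^2 ≤ 2 + 2 r^2`, equivalent to `0 ≤ (1 - r)^2`.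
          nlinarith [sq_nonneg (1 - ∑ j, offMix b E y i j)]
      _ = 2 + 2 * ∑ j, ∑ j', ∫ y, offMix b E y i j * offMix b E y i j'
          ∂(Measure.pi fun _ : Fin N => μ) := by
          rw [integral_add (integrable_const _) (((BddMeas.const 2).mul (BddMeas.sum _ fun j _ =>
            BddMeas.sum _ fun j' _ => (hB i j).mul (hB i j'))).integrable _),
            integral_const_mul, integral_finsetSum _ fun j _ =>
            (BddMeas.sum _ fun j' _ => (hB i j).mul (hB i j')).integrable _]
          simp only [integral_const, probReal_univ, one_smul]
          congr 2
          refine Finset.sum_congr rfl fun j _ => ?_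
          rw [integral_finsetSum _ fun j' _ => ((hB i j).mul (hB i j')).integrable _]
      _ ≤ 2 + 2 * ∑ j : Fin N, ∑ j', ((if j = j' then θ else 0) + ρ) := by
          gcongr with j _ j' _
          exact hpair i j j'
      _ = _ := by
          simp [Finset.sum_add_distrib]; ring
  rw [integral_finsetSum _ fun i _ => (hRB i).integrable _]
  calc _ ≤ ∑ _i : Fin N, (2 + 2 * (N * θ + N ^ 2 * ρ)) := Finset.sum_le_sum fun i _ => hrow i
    _ = _ := by simp; ring

/-- Disjoint pairs of indices are uncorrelated. For pairs with a coincidence the covariance is at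
most the mean product, hence at most `K ^ 4` times the mean of the product of the `offMix` entries.
There are four possible coincidences, each contributing by symmetry the sum of the squared row sums;
hence the factor `4`. -/
lemma integral_sq_ustat_sub_le (hb : ∀ k, BddMeas (b k)) (hb0 : ∀ k x, 0 ≤ b k x)
    (hE0 : ∀ k l, 0 ≤ E k l) (hE : ∀ k l, E k l = E l k)
    {f : X → ℝ} (hf : Measurable f) {K : ℝ} (hK : ∀ x, |f x| ≤ K) :
    ∫ y, (∑ i, ∑ j, offMix b E y i j * (f (y i) * f (y j)) -
        N * (N - 1) * ∑ k, ∑ l, (∫ x, b k x * f x ∂μ) * (∫ x, b l x * f x ∂μ) * E k l) ^ 2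
      ∂(Measure.pi fun _ : Fin N => μ) ≤
    4 * K ^ 4 * ∫ y, ∑ i, (1 + ∑ j, offMix b E y i j) ^ 2 ∂(Measure.pi fun _ : Fin N => μ) := by
  have hfB : BddMeas f := ⟨hf, K, hK⟩
  set θ := ∑ k, ∑ l, (∫ x, b k x * f x ∂μ) * (∫ x, b l x * f x ∂μ) * E k l with hθ
  have hB := fun i j => bddMeas_offMix (E := E) hb i j
  have h0 := fun y i j => offMix_nonneg (b := b) (E := E) hb0 hE0 y i j
  set Y : Fin N × Fin N → (Fin N → X) → ℝ :=
    fun p y => offMix b E y p.1 p.2 * (f (y p.1) * f (y p.2)) with hY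
  have hYB : ∀ p, BddMeas (Y p) := fun p => (hB p.1 p.2).mul
    ((hfB.comp (measurable_pi_apply p.1)).mul (hfB.comp (measurable_pi_apply p.2)))
  -- The centring is `0` on the diagonal, where `offMix` vanishes; this leaves `N * (N - 1)` copies
  -- of `θ`.
  set D : Fin N × Fin N → (Fin N → X) → ℝ :=
    fun p y => Y p y - if p.1 = p.2 then 0 else θ with hD
  have hDB : ∀ p, BddMeas (D p) := fun p => (hYB p).sub (BddMeas.const _)
  have hYθ : ∀ p : Fin N × Fin N, p.1 ≠ p.2 → ∫ y, Y p y ∂(Measure.pi fun _ : Fin N => μ) = θ := by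
    intro p hp
    simp only [hY, offMix, if_neg hp]
    exact integral_mix_mul_mul μ hb hfB hp
  have hK0 : 0 ≤ K ^ 4 := by positivity
  -- `τ p q` counts the coincidences between two pairs of indices
  set τ : Fin N × Fin N → Fin N × Fin N → ℝ := fun p q =>
    (if p.1 = q.1 then 1 else 0) + (if p.1 = q.2 then 1 else 0) +
      (if p.2 = q.1 then 1 else 0) + (if p.2 = q.2 then 1 else 0) with hτ
  have hτ0 : ∀ p q, 0 ≤ τ p q := by
    intro p q
    simp only [hτ]
    split_ifs <;> norm_num
  have hcov : ∀ p q, ∫ y, D p y * D q y ∂(Measure.pi fun _ : Fin N => μ) ≤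
      ∫ y, K ^ 4 * (τ p q * (offMix b E y p.1 p.2 * offMix b E y q.1 q.2))
        ∂(Measure.pi fun _ : Fin N => μ) := by
    intro p q
    have hnn : 0 ≤ ∫ y, K ^ 4 * (τ p q * (offMix b E y p.1 p.2 * offMix b E y q.1 q.2))
        ∂(Measure.pi fun _ : Fin N => μ) :=
      integral_nonneg fun y => mul_nonneg hK0 (mul_nonneg (hτ0 p q) (mul_nonneg (h0 _ _ _)
        (h0 _ _ _)))
    by_cases hp : p.1 = p.2
    · have : ∀ y, D p y = 0 := fun y => by simp [hD, hY, offMix, hp]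
      simpa [this] using hnn
    by_cases hq : q.1 = q.2
    · have : ∀ y, D q y = 0 := fun y => by simp [hD, hY, offMix, hq]
      simpa [this] using hnn
    have hexp : ∫ y, D p y * D q y ∂(Measure.pi fun _ : Fin N => μ) =
        (∫ y, Y p y * Y q y ∂(Measure.pi fun _ : Fin N => μ)) - θ * θ := by
      have h1 : ∀ y, D p y * D q y = Y p y * Y q y - θ * Y p y - θ * Y q y + θ * θ := by
        intro y
        simp only [hD, if_neg hp, if_neg hq]
        ring
      simp_rw [h1]
      rw [integral_add (((((hYB p).mul (hYB q)).sub ((BddMeas.const θ).mul (hYB p))).sub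
          ((BddMeas.const θ).mul (hYB q))).integrable _) (integrable_const _),
        integral_sub ((((hYB p).mul (hYB q)).sub ((BddMeas.const θ).mul (hYB p))).integrable _)
          (((BddMeas.const θ).mul (hYB q)).integrable _),
        integral_sub (((hYB p).mul (hYB q)).integrable _)
          (((BddMeas.const θ).mul (hYB p)).integrable _), integral_const_mul, integral_const_mul,
        hYθ p hp, hYθ q hq]
      simp
    by_cases hdis : p.1 ≠ q.1 ∧ p.1 ≠ q.2 ∧ p.2 ≠ q.1 ∧ p.2 ≠ q.2
    · obtain ⟨ha, hb', hc, hd⟩ := hdis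
      have hmm : Measurable fun z : X × X => mix b E z.1 z.2 * (f z.1 * f z.2) :=
        (bddMeas_mix hb).1.mul (by fun_prop)
      have := integral_pi_pair_mul_pair μ ha hb' hc hd hmm hmm
      have hYe : ∀ r : Fin N × Fin N, r.1 ≠ r.2 →
          Y r = fun y => mix b E (y r.1) (y r.2) * (f (y r.1) * f (y r.2)) := by
        intro r hr
        funext y
        simp [hY, offMix, hr]
      have h2 : ∫ y, Y p y * Y q y ∂(Measure.pi fun _ : Fin N => μ) = θ * θ := by
        nth_rewrite 1 [← hYθ p hp]
        rw [← hYθ q hq, hYe p hp, hYe q hq]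
        exact this
      rw [hexp, h2, sub_self]
      exact hnn
    · have hτ1 : 1 ≤ τ p q := by
        simp only [hτ]
        split_ifs with h1 h2 h3 h4 h4 h3 h4 h4 h2 h3 h4 h4 h3 h4 h4 <;> norm_num
        exact hdis ⟨h1, h2, h3, h4⟩
      rw [hexp]
      -- The covariance is bounded by the mean product by discarding `θ ^ 2`.
      refine (sub_le_self _ (mul_self_nonneg θ)).trans ?_
      refine integral_mono (((hYB p).mul (hYB q)).integrable _) (((BddMeas.const _).mul
        ((BddMeas.const _).mul ((hB p.1 p.2).mul (hB q.1 q.2)))).integrable _) fun y => ?_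
      have hff : ∀ a c d e : X, |f a * f c * (f d * f e)| ≤ K ^ 4 := by
        intro a c d e
        rw [abs_mul, abs_mul, abs_mul]
        have hKn : 0 ≤ K := (abs_nonneg _).trans (hK a)
        calc _ ≤ K * K * (K * K) := by gcongr <;> apply hK
          _ = K ^ 4 := by ring
      have hee : 0 ≤ offMix b E y p.1 p.2 * offMix b E y q.1 q.2 := mul_nonneg (h0 _ _ _) (h0 _ _ _)
      calc Y p y * Y q y = (f (y p.1) * f (y p.2) * (f (y q.1) * f (y q.2))) *
            (offMix b E y p.1 p.2 * offMix b E y q.1 q.2) := by simp only [hY]; ring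
        _ ≤ K ^ 4 * (offMix b E y p.1 p.2 * offMix b E y q.1 q.2) :=
            mul_le_mul_of_nonneg_right ((le_abs_self _).trans (hff _ _ _ _)) hee
        _ ≤ K ^ 4 * (τ p q * (offMix b E y p.1 p.2 * offMix b E y q.1 q.2)) :=
            mul_le_mul_of_nonneg_left (le_mul_of_one_le_left hee hτ1) hK0
  have hsum : ∀ y, ∑ i, ∑ j, offMix b E y i j * (f (y i) * f (y j)) - N * (N - 1) * θ =
      ∑ p, D p y := by
    intro y
    simp only [hD, Finset.sum_sub_distrib, Fintype.sum_prod_type, hY]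
    congr 1
    have : ∀ i j : Fin N, (if i = j then (0 : ℝ) else θ) = θ - if i = j then θ else 0 := by
      intro i j; split_ifs <;> simp
    simp [this]
    ring
  have hsq : ∀ y, (∑ i, ∑ j, offMix b E y i j * (f (y i) * f (y j)) - N * (N - 1) * θ) ^ 2 =
      ∑ p, ∑ q, D p y * D q y := by
    intro y
    rw [hsum, sq, Finset.sum_mul_sum]
  simp_rw [hsq]
  rw [integral_finsetSum _ fun p _ => (BddMeas.sum _ fun q _ =>
    (hDB p).mul (hDB q)).integrable _]
  have hTB : ∀ p q, BddMeas fun y : Fin N → X =>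
      K ^ 4 * (τ p q * (offMix b E y p.1 p.2 * offMix b E y q.1 q.2)) := fun p q =>
    (BddMeas.const _).mul ((BddMeas.const _).mul ((hB p.1 p.2).mul (hB q.1 q.2)))
  calc _ ≤ ∑ p, ∑ q, ∫ y, K ^ 4 * (τ p q * (offMix b E y p.1 p.2 * offMix b E y q.1 q.2))
        ∂(Measure.pi fun _ : Fin N => μ) := by
        refine Finset.sum_le_sum fun p _ => ?_
        rw [integral_finsetSum _ fun q _ => ((hDB p).mul (hDB q)).integrable _]
        exact Finset.sum_le_sum fun q _ => hcov p q
    _ = ∫ y, ∑ p, ∑ q, K ^ 4 * (τ p q * (offMix b E y p.1 p.2 * offMix b E y q.1 q.2))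
        ∂(Measure.pi fun _ : Fin N => μ) := by
        rw [integral_finsetSum _ fun p _ => (BddMeas.sum _ fun q _ => hTB p q).integrable _]
        refine Finset.sum_congr rfl fun p _ => ?_
        rw [integral_finsetSum _ fun q _ => (hTB p q).integrable _]
    _ ≤ ∫ y, 4 * K ^ 4 * ∑ i, (1 + ∑ j, offMix b E y i j) ^ 2
        ∂(Measure.pi fun _ : Fin N => μ) := by
        refine integral_mono ((BddMeas.sum _ fun p _ => BddMeas.sum _ fun q _ =>
          hTB p q).integrable _) (((BddMeas.const _).mul (BddMeas.sum _ fun i _ =>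
          ((BddMeas.const 1).add (BddMeas.sum _ fun j _ => hB i j)).pow 2)).integrable _)
          fun y => ?_
        set r : Fin N → ℝ := fun i => ∑ j, offMix b E y i j with hr
        have hr' : ∀ j, ∑ i, offMix b E y i j = r j := fun j =>
          Finset.sum_congr rfl fun i _ => offMix_symm hE y i j
        have hr0 : ∀ i, 0 ≤ r i := fun i => Finset.sum_nonneg fun j _ => h0 _ _ _
        have hcount : ∑ p : Fin N × Fin N, ∑ q : Fin N × Fin N,
            K ^ 4 * (τ p q * (offMix b E y p.1 p.2 * offMix b E y q.1 q.2)) =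
            4 * K ^ 4 * ∑ i, r i ^ 2 := by
          have hq : ∀ p : Fin N × Fin N, ∑ q : Fin N × Fin N,
              K ^ 4 * (τ p q * (offMix b E y p.1 p.2 * offMix b E y q.1 q.2)) =
              K ^ 4 * (offMix b E y p.1 p.2 * (2 * r p.1 + 2 * r p.2)) := by
            intro p
            rw [← Finset.mul_sum]
            congr 1
            have : ∀ q, τ p q * (offMix b E y p.1 p.2 * offMix b E y q.1 q.2) =
                offMix b E y p.1 p.2 * (τ p q * offMix b E y q.1 q.2) := fun q => by ring
            simp_rw [this]
            rw [← Finset.mul_sum]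
            congr 1
            simp only [hτ, add_mul, ite_mul, one_mul, zero_mul, Finset.sum_add_distrib,
              Fintype.sum_prod_type]
            have e1 : ∀ a : Fin N, ∑ x, ∑ x', (if a = x then offMix b E y x x' else 0) = r a := by
              intro a
              rw [Finset.sum_comm]
              simp [hr]
            have e2 : ∀ a : Fin N, ∑ x, ∑ x', (if a = x' then offMix b E y x x' else 0) = r a := by
              intro a
              simp [hr']
            rw [e1, e2, e1, e2]
            ring
          simp_rw [hq]
          rw [← Finset.mul_sum, Fintype.sum_prod_type]
          simp only [mul_add, Finset.sum_add_distrib]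
          have e3 : ∑ i, ∑ j, offMix b E y i j * (2 * r i) = 2 * ∑ i, r i ^ 2 := by
            simp_rw [← Finset.sum_mul, Finset.mul_sum]
            exact Finset.sum_congr rfl fun i _ => by simp only [hr]; ring
          have e4 : ∑ i, ∑ j, offMix b E y i j * (2 * r j) = 2 * ∑ i, r i ^ 2 := by
            rw [Finset.sum_comm]
            simp_rw [← Finset.sum_mul, hr', Finset.mul_sum]
            exact Finset.sum_congr rfl fun i _ => by ring
          rw [e3, e4]
          ring
        simp only
        rw [hcount]
        have : ∀ i, r i ^ 2 ≤ (1 + r i) ^ 2 := fun i => by nlinarith [hr0 i]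
        exact mul_le_mul_of_nonneg_left (Finset.sum_le_sum fun i _ => this i) (by positivity)
    _ = _ := by rw [integral_const_mul]

end UStat

/-! ### Calculus of convergence in probability to constants. -/

namespace TendstoInProbability

variable {Ω : ℕ → Type*} [∀ N, MeasurableSpace (Ω N)] {P : ∀ N, Measure (Ω N)}
  {V W B : ∀ N, Ω N → ℝ} {c d : ℝ}

lemma congr' (hV : TendstoInProbability P V c) (h : ∀ᶠ N in atTop, ∀ ω, W N ω = V N ω) :
    TendstoInProbability P W c := by
  intro ε hε
  refine (hV ε hε).congr' ?_
  filter_upwards [h] with N hN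
  simp_rw [hN]

lemma of_tendsto {a : ℕ → ℝ} (ha : Tendsto a atTop (𝓝 c)) :
    TendstoInProbability P (fun N _ => a N) c := by
  intro ε hε
  refine tendsto_const_nhds.congr' ?_
  filter_upwards [Metric.tendsto_nhds.1 ha ε hε] with N hN
  rw [Real.dist_eq] at hN
  simp [not_le.2 hN]

lemma const (c : ℝ) : TendstoInProbability P (fun _ _ => c) c := of_tendsto tendsto_const_nhds

lemma map₂ {F : ℝ × ℝ → ℝ} (hF : ContinuousAt F (c, d)) (hV : TendstoInProbability P V c)
    (hW : TendstoInProbability P W d) :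
    TendstoInProbability P (fun N ω => F (V N ω, W N ω)) (F (c, d)) := by
  intro ε hε
  obtain ⟨δ, hδ, h⟩ := Metric.continuousAt_iff.1 hF ε hε
  refine tendsto_of_tendsto_of_tendsto_of_le_of_le tendsto_const_nhds
    (by simpa using (hV δ hδ).add (hW δ hδ)) (fun _ => zero_le) fun N => ?_
  refine (measure_mono fun ω hω => ?_).trans (measure_union_le _ _)
  by_contra hcon
  simp only [Set.mem_union, Set.mem_ofPred_eq, not_or, not_le] at hcon
  have := @h (V N ω, W N ω) (by
    rw [Prod.dist_eq, max_lt_iff, Real.dist_eq, Real.dist_eq]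
    exact hcon)
  rw [Real.dist_eq] at this
  exact absurd hω (not_le.2 this)

lemma add (hV : TendstoInProbability P V c) (hW : TendstoInProbability P W d) :
    TendstoInProbability P (fun N ω => V N ω + W N ω) (c + d) :=
  map₂ (F := fun p => p.1 + p.2) (by fun_prop) hV hW

lemma mul (hV : TendstoInProbability P V c) (hW : TendstoInProbability P W d) :
    TendstoInProbability P (fun N ω => V N ω * W N ω) (c * d) :=
  map₂ (F := fun p => p.1 * p.2) (by fun_prop) hV hW

lemma div (hV : TendstoInProbability P V c) (hW : TendstoInProbability P W d) (hd : d ≠ 0) :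
    TendstoInProbability P (fun N ω => V N ω / W N ω) (c / d) :=
  map₂ (F := fun p => p.1 / p.2) (continuousAt_fst.div continuousAt_snd hd) hV hW

lemma map {F : ℝ → ℝ} (hF : ContinuousAt F c) (hV : TendstoInProbability P V c) :
    TendstoInProbability P (fun N ω => F (V N ω)) (F c) :=
  map₂ (F := fun p => F p.1) (hF.comp (x := (c, c)) continuousAt_fst) hV hV

lemma of_abs_sub_le (hV : TendstoInProbability P V c) (hB : TendstoInProbability P B 0)
    (h : ∀ᶠ N in atTop, ∀ ω, |W N ω - V N ω| ≤ B N ω) : TendstoInProbability P W c := by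
  have h0 : TendstoInProbability P (fun N ω => W N ω - V N ω) 0 := by
    intro ε hε
    refine tendsto_of_tendsto_of_tendsto_of_le_of_le' tendsto_const_nhds (hB ε hε)
      (Eventually.of_forall fun _ => zero_le) ?_
    filter_upwards [h] with N hN
    refine measure_mono fun ω hω => ?_
    simp only [Set.mem_ofPred_eq, sub_zero] at hω ⊢
    exact (hω.trans (hN ω)).trans (le_abs_self _)
  simpa using hV.add h0

/-- Chebyshev's inequality. Stating the second moment as a lower integral spares any integrability
requirement on functionals of the particle path. -/
lemma of_lintegral_sq_le (hV : TendstoInProbability P V c) (C : ℝ)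
    (hm : ∀ᶠ N in atTop, Measurable fun ω => W N ω - V N ω)
    (h : ∀ᶠ N : ℕ in atTop, ∫⁻ ω, ENNReal.ofReal ((W N ω - V N ω) ^ 2) ∂(P N) ≤
      ENNReal.ofReal (C / N)) : TendstoInProbability P W c := by
  have h0 : TendstoInProbability P (fun N ω => W N ω - V N ω) 0 := by
    intro ε hε
    have hlim : Tendsto (fun N : ℕ => ENNReal.ofReal (C / N) / ENNReal.ofReal (ε ^ 2)) atTop
        (𝓝 0) := by
      have h1 : Tendsto (fun N : ℕ => ENNReal.ofReal (C / N)) atTop (𝓝 0) := by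
        have := ENNReal.tendsto_ofReal (tendsto_const_div_atTop_nhds_zero_nat C)
        simpa using this
      have h2 := ENNReal.Tendsto.div_const (b := ENNReal.ofReal (ε ^ 2)) h1
        (Or.inr (by simpa using hε.ne'))
      simpa using h2
    refine tendsto_of_tendsto_of_tendsto_of_le_of_le' tendsto_const_nhds hlim
      (Eventually.of_forall fun _ => zero_le) ?_
    filter_upwards [h, hm] with N hN hmN
    have hε2 : ENNReal.ofReal (ε ^ 2) ≠ 0 := by simpa using hε.ne'
    refine le_trans ?_ ((meas_ge_le_lintegral_div (μ := P N)
      (f := fun ω => ENNReal.ofReal ((W N ω - V N ω) ^ 2))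
      (hmN.pow_const 2).ennreal_ofReal.aemeasurable hε2
      ENNReal.ofReal_ne_top).trans (ENNReal.div_le_div_right hN _))
    refine measure_mono fun ω hω => ?_
    simp only [Set.mem_ofPred_eq, sub_zero] at hω ⊢
    refine ENNReal.ofReal_le_ofReal ?_
    rw [← sq_abs (W N ω - V N ω)]
    exact pow_le_pow_left₀ hε.le hω 2
  simpa using hV.add h0

end TendstoInProbability

/-! ### Sums over index paths and their one-step recursion. -/

section PathSum

variable {ι : Type*} [Fintype ι] [DecidableEq ι]

/-- Total weight of the index paths of length `t + 1` that end in `a`. -/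
def pathSum (A : ℕ → ι → ι → ℝ) (u : ι → ℝ) (t : ℕ) (a : ι) : ℝ :=
  ∑ k : Fin (t + 1) → ι, if k (Fin.last t) = a then
    u (k 0) * ∏ s : Fin t, A s (k s.succ) (k s.castSucc) else 0

lemma pathSum_zero (A : ℕ → ι → ι → ℝ) (u : ι → ℝ) (a : ι) : pathSum A u 0 a = u a := by
  unfold pathSum
  rw [← (Equiv.funUnique (Fin 1) ι).symm.sum_comp]
  simp

lemma pathSum_succ (A : ℕ → ι → ι → ℝ) (u : ι → ℝ) (t : ℕ) (a : ι) :
    pathSum A u (t + 1) a = ∑ b, A t a b * pathSum A u t b := by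
  unfold pathSum
  rw [← (Fin.snocEquiv fun _ : Fin (t + 2) => ι).sum_comp, Fintype.sum_prod_type]
  simp only [Fin.snocEquiv, Equiv.coe_fn_mk, Fin.snoc_last]
  rw [Finset.sum_eq_single a (fun b _ hb => by simp [hb]) (by simp)]
  simp only [if_true]
  have h1 : ∀ k : Fin (t + 1) → ι,
      (u ((Fin.snoc k a : Fin (t + 2) → ι) 0) * ∏ s : Fin (t + 1),
        A s ((Fin.snoc k a : Fin (t + 2) → ι) s.succ)
          ((Fin.snoc k a : Fin (t + 2) → ι) s.castSucc)) =
      A t a (k (Fin.last t)) * (u (k 0) * ∏ s : Fin t, A s (k s.succ) (k s.castSucc)) := by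
    intro k
    have h0 : (Fin.snoc k a : Fin (t + 2) → ι) 0 = k 0 := by
      rw [← Fin.castSucc_zero, Fin.snoc_castSucc]
    rw [Fin.prod_univ_castSucc, h0]
    simp only [Fin.succ_last, Fin.snoc_last, Fin.snoc_castSucc, ← Fin.castSucc_succ,
      Fin.val_castSucc, Fin.val_last]
    ring
  simp only [Finset.mul_sum]
  rw [Finset.sum_comm]
  refine Finset.sum_congr rfl fun k _ => ?_
  simp only [mul_ite, mul_zero, Finset.sum_ite_eq, Finset.mem_univ, if_true]
  exact h1 k

/-- Row-stochastic transitions preserve the constant function; this evaluates the normalizer in the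
conditional probability `T`. -/
lemma pathSum_one {A : ℕ → ι → ι → ℝ} (hA : ∀ s a, ∑ b, A s a b = 1) (t : ℕ) (a : ι) :
    pathSum A (fun _ => 1) t a = 1 := by
  induction t generalizing a with
  | zero => rw [pathSum_zero]
  | succ t ih => simp_rw [pathSum_succ, ih, mul_one, hA]

end PathSum

/-! ### Meeting probabilities of backward trajectories. -/

namespace Model

variable {X : Type*} [MeasurableSpace X] (S : Model X) {N : ℕ}

/-- Probability, given the particles and the terminal indices `i`, `j`, that two independent
backward trajectories have met at some time at most `t`. -/
def meet (m : ℕ → X → X → ℝ) (x : ℕ → Fin N → X) : ℕ → Fin N → Fin N → ℝ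
  | 0, i, j => if i = j then 1 else 0
  | t + 1, i, j => if i = j then 1 else
      ∑ k, ∑ l, S.betaBS m x t i k * S.betaBS m x t j l * meet m x t k l

variable {S} {m : ℕ → X → X → ℝ}

lemma betaBS_sum (hg : ∀ t x, 0 < S.g t x) (hm : ∀ t x y, 0 < m t x y) (x : ℕ → Fin N → X)
    (s : ℕ) (k : Fin N) : ∑ l, S.betaBS m x s k l = 1 := by
  unfold betaBS
  rw [← Finset.sum_div, div_self]
  exact (Finset.sum_pos (fun j _ => mul_pos (hg _ _) (hm _ _ _)) ⟨k, Finset.mem_univ k⟩).ne'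

lemma betaBS_nonneg (hg : ∀ t x, 0 < S.g t x) (hm : ∀ t x y, 0 < m t x y) (x : ℕ → Fin N → X)
    (s : ℕ) (k l : Fin N) : 0 ≤ S.betaBS m x s k l :=
  div_nonneg (mul_pos (hg _ _) (hm _ _ _)).le
    (Finset.sum_nonneg fun _ _ => (mul_pos (hg _ _) (hm _ _ _)).le)

lemma sum_g_pos [NeZero N] (hg : ∀ t x, 0 < S.g t x) (t : ℕ) (z : Fin N → X) :
    0 < ∑ j, S.g t (z j) :=
  Finset.sum_pos (fun _ _ => hg _ _) ⟨0, Finset.mem_univ _⟩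

lemma weight_sum [NeZero N] (hg : ∀ t x, 0 < S.g t x) (x : ℕ → Fin N → X) (t : ℕ) :
    ∑ i, S.weight x t i = 1 := by
  unfold weight
  rw [← Finset.sum_div, div_self (sum_g_pos hg t (x t)).ne']

/-- The pair of trajectories is read as one path of pairs. The indicator of never meeting factorizes
over times: time `0` goes into the initial weight and each later time into the transition leaving it
backward. Off the diagonal the second law uses only `betaBS`, and the common factor `N⁻¹ * N⁻¹`
cancels. -/
lemma T_eq_pathSum (x : ℕ → Fin N → X) (t : ℕ) (i j : Fin N) (hN : N ≠ 0) :
    S.T m x t (fun _ => 0) i j =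
      pathSum (fun s (a c : Fin N × Fin N) => if a.1 = a.2 then 0 else
        S.betaBS m x s a.1 c.1 * S.betaBS m x s a.2 c.2)
        (fun a => if a.1 = a.2 then 0 else 1) t (i, j) /
      pathSum (fun s (a c : Fin N × Fin N) => S.betaBS m x s a.1 c.1 *
        if a.2 = a.1 then S.weight x s c.2 else S.betaBS m x s a.2 c.2)
        (fun _ => 1) t (i, j) := by
  have hN' : (N : ℝ) ≠ 0 := Nat.cast_ne_zero.2 hN
  unfold T pathSum
  have hden : ∀ F : (Fin (t + 1) → Fin N) → (Fin (t + 1) → Fin N) → ℝ, ∑ k₁, ∑ k₂, F k₁ k₂ =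
      ∑ k : Fin (t + 1) → Fin N × Fin N, F (fun s => (k s).1) (fun s => (k s).2) := by
    intro F
    rw [← Fintype.sum_prod_type' (f := F)]
    exact ((Equiv.arrowProdEquivProdArrow (Fin (t + 1)) (fun _ => Fin N) (fun _ => Fin N)).sum_comp
      (fun p : (Fin (t + 1) → Fin N) × (Fin (t + 1) → Fin N) => F p.1 p.2)).symm
  rw [hden, hden]
  have e1 : ∀ k : Fin (t + 1) → Fin N × Fin N,
      (if (k (Fin.last t)).1 = i ∧ (k (Fin.last t)).2 = j then
        S.Lambda₁ m x t (fun s => (k s).1) * S.Lambda₂ m x t (fun s => (k s).1) (fun s => (k s).2)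
          * coal (fun _ => 0) (fun s => (k s).1) (fun s => (k s).2) else 0) =
      ((N : ℝ)⁻¹ * (N : ℝ)⁻¹) * if k (Fin.last t) = (i, j) then
        (if (k 0).1 = (k 0).2 then 0 else 1) * ∏ s : Fin t,
          (if (k s.succ).1 = (k s.succ).2 then 0 else
            S.betaBS m x s (k s.succ).1 (k s.castSucc).1 *
              S.betaBS m x s (k s.succ).2 (k s.castSucc).2) else 0 := by
    intro k
    simp only [Prod.ext_iff, mul_ite, mul_zero]
    congr 1
    by_cases hc : ∀ s, (k s).1 ≠ (k s).2
    · have hco : coal (N := N) (fun _ : Fin (t + 1) => 0) (fun s => (k s).1) (fun s => (k s).2)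
          = 1 := by
        simp [coal, hc]
      simp only [hco, Lambda₁, Lambda₂, if_neg (hc _), if_neg (hc _).symm, one_mul, mul_one,
        Finset.prod_mul_distrib]
      ring
    · push Not at hc
      obtain ⟨s, hs⟩ := hc
      have hco : coal (N := N) (fun _ : Fin (t + 1) => 0) (fun s => (k s).1) (fun s => (k s).2)
          = 0 := by
        simp only [coal]
        rw [if_neg]
        intro h
        simpa using (h s).1 hs
      rw [hco, mul_zero]
      -- A meeting at time `0` annihilates the initial weight, and one at time `r + 1` the `r`-th
      -- factor.
      rcases Fin.eq_zero_or_eq_succ s with rfl | ⟨r, rfl⟩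
      · simp [hs]
      · rw [Finset.prod_eq_zero (Finset.mem_univ r) (by simp [hs])]
        simp
  have e2 : ∀ k : Fin (t + 1) → Fin N × Fin N,
      (if (k (Fin.last t)).1 = i ∧ (k (Fin.last t)).2 = j then
        S.Lambda₁ m x t (fun s => (k s).1) * S.Lambda₂ m x t (fun s => (k s).1) (fun s => (k s).2)
          else 0) =
      ((N : ℝ)⁻¹ * (N : ℝ)⁻¹) * if k (Fin.last t) = (i, j) then
        1 * ∏ s : Fin t, (S.betaBS m x s (k s.succ).1 (k s.castSucc).1 *
          if (k s.succ).2 = (k s.succ).1 then S.weight x s (k s.castSucc).2 else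
            S.betaBS m x s (k s.succ).2 (k s.castSucc).2) else 0 := by
    intro k
    simp only [Prod.ext_iff, mul_ite, mul_zero]
    congr 1
    simp only [Lambda₁, Lambda₂, one_mul, ← mul_ite, Finset.prod_mul_distrib]
    ring
  simp_rw [e1, e2]
  rw [← Finset.mul_sum, ← Finset.mul_sum, mul_div_mul_left]
  exact mul_ne_zero (inv_ne_zero hN') (inv_ne_zero hN')

/-- The denominator is `1`, since each branch of the pair transition is stochastic, and the
numerator satisfies the recursion complementary to that of `meet`. -/
lemma T_eq_one_sub_meet [NeZero N] (hg : ∀ t x, 0 < S.g t x) (hm : ∀ t x y, 0 < m t x y)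
    (x : ℕ → Fin N → X) (t : ℕ) (i j : Fin N) :
    S.T m x t (fun _ => 0) i j = 1 - S.meet m x t i j := by
  rw [T_eq_pathSum x t i j (NeZero.ne N), pathSum_one, div_one]
  · induction t generalizing i j with
    | zero =>
      rw [pathSum_zero]
      simp only [meet]
      split_ifs <;> simp
    | succ t ih =>
      rw [pathSum_succ, Fintype.sum_prod_type]
      simp only [ih, meet]
      by_cases hij : i = j
      · simp [hij]
      · simp only [if_neg hij, mul_sub, mul_one, Finset.sum_sub_distrib]
        rw [← Finset.sum_mul_sum, betaBS_sum hg hm, betaBS_sum hg hm, one_mul]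
  · rintro s ⟨a, b⟩
    rw [Fintype.sum_prod_type]
    simp only
    rw [← Finset.sum_mul_sum, betaBS_sum hg hm, one_mul]
    split_ifs
    · exact weight_sum hg x s
    · exact betaBS_sum hg hm x s b

lemma meet_nonneg (hg : ∀ t x, 0 < S.g t x) (hm : ∀ t x y, 0 < m t x y) (x : ℕ → Fin N → X)
    (t : ℕ) (i j : Fin N) : 0 ≤ S.meet m x t i j := by
  induction t generalizing i j with
  | zero => simp only [meet]; split_ifs <;> norm_num
  | succ t ih =>
    simp only [meet]
    split_ifs
    · norm_num
    · exact Finset.sum_nonneg fun k _ => Finset.sum_nonneg fun l _ => mul_nonneg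
        (mul_nonneg (betaBS_nonneg hg hm _ _ _ _) (betaBS_nonneg hg hm _ _ _ _)) (ih k l)

lemma meet_le_one (hg : ∀ t x, 0 < S.g t x) (hm : ∀ t x y, 0 < m t x y) (x : ℕ → Fin N → X)
    (t : ℕ) (i j : Fin N) : S.meet m x t i j ≤ 1 := by
  induction t generalizing i j with
  | zero => simp only [meet]; split_ifs <;> norm_num
  | succ t ih =>
    simp only [meet]
    split_ifs
    · norm_num
    · calc _ ≤ ∑ k, ∑ l, S.betaBS m x t i k * S.betaBS m x t j l * 1 := by
            gcongr with k _ l _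
            · exact mul_nonneg (betaBS_nonneg hg hm _ _ _ _) (betaBS_nonneg hg hm _ _ _ _)
            · exact ih k l
        _ = 1 := by
            simp_rw [mul_one]
            rw [← Finset.sum_mul_sum, betaBS_sum hg hm, betaBS_sum hg hm, one_mul]

lemma meet_symm (x : ℕ → Fin N → X) (t : ℕ) (i j : Fin N) :
    S.meet m x t i j = S.meet m x t j i := by
  induction t generalizing i j with
  | zero => simp only [meet, eq_comm]
  | succ t ih =>
    simp only [meet, eq_comm (a := i)]
    rw [Finset.sum_comm]
    simp only [ih, mul_comm (S.betaBS m x t i _)]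

lemma meet_self (x : ℕ → Fin N → X) (t : ℕ) (i : Fin N) : S.meet m x t i i = 1 := by
  cases t <;> simp [meet]

lemma meet_congr {x x' : ℕ → Fin N → X} {t : ℕ} (h : ∀ s ≤ t, x s = x' s) (i j : Fin N) :
    S.meet m x t i j = S.meet m x' t i j := by
  induction t generalizing i j with
  | zero => rfl
  | succ t ih =>
    simp only [meet, betaBS, h t (Nat.le_succ t), h (t + 1) le_rfl,
      fun k l => ih (fun s hs => h s (hs.trans (Nat.le_succ t))) k l]

lemma measurable_betaBS (hm : ∀ t, Measurable (Function.uncurry (m t))) (s : ℕ) (k l : Fin N) :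
    Measurable fun x : ℕ → Fin N → X => S.betaBS m x s k l := by
  have hm' : ∀ k l, Measurable fun x : ℕ → Fin N → X => m s (x s l) (x (s + 1) k) := fun k l =>
    (hm s).comp (by fun_prop : Measurable fun x : ℕ → Fin N → X => (x s l, x (s + 1) k))
  have hg := S.measurable_g s
  unfold betaBS
  fun_prop

lemma measurable_meet (hm : ∀ t, Measurable (Function.uncurry (m t))) (t : ℕ) (i j : Fin N) :
    Measurable fun x : ℕ → Fin N → X => S.meet m x t i j := by
  induction t generalizing i j with
  | zero => exact measurable_const
  | succ t ih =>
    simp only [meet]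
    split_ifs
    · exact measurable_const
    · have := measurable_betaBS (S := S) (N := N) hm t
      fun_prop

end Model

/-! ### Mixture law of the next generation and its ancestor posterior. -/

namespace Model

variable {X : Type*} [MeasurableSpace X] (S : Model X) {N : ℕ}

/-- The conditional law of a particle at time `t + 1` given the particles `z` at time `t`. -/
def mixLaw (t : ℕ) (z : Fin N → X) : Measure X :=
  ∑ k, ENNReal.ofReal (S.g t (z k) / ∑ j, S.g t (z j)) • S.M t (z k)

variable {S}

lemma mixLaw_apply (t : ℕ) (z : Fin N → X) (B : Set X) :
    S.mixLaw t z B = ∑ k, ENNReal.ofReal (S.g t (z k) / ∑ j, S.g t (z j)) * S.M t (z k) B := by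
  simp [mixLaw, Measure.coe_finsetSum]

lemma isProbabilityMeasure_mixLaw [NeZero N] (hg : ∀ t x, 0 < S.g t x) (t : ℕ) (z : Fin N → X) :
    IsProbabilityMeasure (S.mixLaw t z) := by
  constructor
  rw [mixLaw_apply]
  simp only [measure_univ, mul_one]
  rw [← ENNReal.ofReal_sum_of_nonneg fun k _ =>
    div_nonneg (hg _ _).le (sum_g_pos hg t z).le, ← Finset.sum_div,
    div_self (sum_g_pos hg t z).ne', ENNReal.ofReal_one]

lemma measurable_mixLaw_apply (t : ℕ) {B : Set X} (hB : MeasurableSet B) :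
    Measurable fun z : Fin N → X => S.mixLaw t z B := by
  simp_rw [mixLaw_apply]
  have hg := S.measurable_g t
  have hM : ∀ k, Measurable fun z : Fin N → X => S.M t (z k) B := fun k =>
    ((S.M t).measurable_coe hB).comp (measurable_pi_apply k)
  fun_prop

lemma measurable_pi_mixLaw [NeZero N] (hg : ∀ t x, 0 < S.g t x) (t : ℕ) :
    Measurable fun z : Fin N → X => Measure.pi fun _ : Fin N => S.mixLaw t z := by
  have := fun z : Fin N → X => isProbabilityMeasure_mixLaw hg t z
  refine Measurable.measure_of_isPiSystem_of_isProbabilityMeasure generateFrom_pi.symm isPiSystem_pi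
    ?_
  rintro _ ⟨B, hB, rfl⟩
  simp_rw [Measure.pi_pi]
  exact Finset.measurable_fun_prod _ fun i _ =>
    measurable_mixLaw_apply t (hB i (Set.mem_univ i))

lemma mixLaw_real [NeZero N] (hg : ∀ t x, 0 < S.g t x) (t : ℕ) (z : Fin N → X) (B : Set X) :
    S.mixLaw t z B =
      ENNReal.ofReal (∑ k, (S.g t (z k) / ∑ j, S.g t (z j)) * (S.M t (z k)).real B) := by
  rw [mixLaw_apply, ENNReal.ofReal_sum_of_nonneg fun k _ => mul_nonneg
    (div_nonneg (hg _ _).le (sum_g_pos hg t z).le) measureReal_nonneg]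
  refine Finset.sum_congr rfl fun k _ => ?_
  rw [ENNReal.ofReal_mul (div_nonneg (hg _ _).le (sum_g_pos hg t z).le), ofReal_measureReal]

lemma integral_mixLaw [NeZero N] (hg : ∀ t x, 0 < S.g t x) (t : ℕ) (z : Fin N → X) {f : X → ℝ}
    (hf : BddMeas f) :
    ∫ y, f y ∂(S.mixLaw t z) = ∑ k, (S.g t (z k) / ∑ j, S.g t (z j)) * ∫ y, f y ∂(S.M t (z k)) := by
  unfold mixLaw
  rw [integral_finsetSum_measure fun k _ => (hf.integrable _).smul_measure ENNReal.ofReal_ne_top]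
  refine Finset.sum_congr rfl fun k _ => ?_
  rw [integral_smul_measure, ENNReal.toReal_ofReal
    (div_nonneg (hg _ _).le (sum_g_pos hg t z).le), smul_eq_mul]

/-- The backward weight as a function of the child position. -/
def backW (S : Model X) (m : ℕ → X → X → ℝ) (t : ℕ) (z : Fin N → X) (k : Fin N) (y : X) : ℝ :=
  S.g t (z k) * m t (z k) y / ∑ j, S.g t (z j) * m t (z j) y

section backW

variable {m : ℕ → X → X → ℝ}

lemma backW_nonneg (hg : ∀ t x, 0 < S.g t x) (hm : ∀ t x y, 0 < m t x y) (t : ℕ) (z : Fin N → X)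
    (k : Fin N) (y : X) : 0 ≤ S.backW m t z k y :=
  div_nonneg (mul_pos (hg _ _) (hm _ _ _)).le
    (Finset.sum_nonneg fun _ _ => (mul_pos (hg _ _) (hm _ _ _)).le)

lemma backW_sum [NeZero N] (hg : ∀ t x, 0 < S.g t x) (hm : ∀ t x y, 0 < m t x y) (t : ℕ)
    (z : Fin N → X) (y : X) : ∑ k, S.backW m t z k y = 1 := by
  unfold backW
  rw [← Finset.sum_div, div_self]
  exact (Finset.sum_pos (fun j _ => mul_pos (hg _ _) (hm _ _ _)) ⟨0, Finset.mem_univ _⟩).ne'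

lemma measurable_backW (hmm : ∀ t, Measurable (Function.uncurry (m t))) (t : ℕ) (k : Fin N) :
    Measurable fun p : (Fin N → X) × X => S.backW m t p.1 k p.2 := by
  have hg := S.measurable_g t
  have hm' : ∀ k, Measurable fun p : (Fin N → X) × X => m t (p.1 k) p.2 := fun k =>
    (hmm t).comp (by fun_prop : Measurable fun p : (Fin N → X) × X => (p.1 k, p.2))
  unfold backW
  fun_prop

lemma bddMeas_backW [NeZero N] (hg : ∀ t x, 0 < S.g t x) (hm : ∀ t x y, 0 < m t x y)
    (hmm : ∀ t, Measurable (Function.uncurry (m t))) (t : ℕ) (z : Fin N → X) (k : Fin N) :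
    BddMeas (S.backW m t z k) :=
  ⟨(measurable_backW hmm t k).comp measurable_prodMk_left, 1,
    le_one_of_sum_eq_one (backW_nonneg hg hm t z) (backW_sum hg hm t z) k⟩

/-- Bayes' formula: up to the normalization of the weights, the denominator of `backW` is the
`ν`-density of the mixture law, so it cancels and only the `k`-th component remains. -/
lemma integral_backW_mul [NeZero N] {ν : Measure X} {m₀ : X → ℝ} (hd : HasDensities S ν m₀ m)
    (hg : ∀ t x, 0 < S.g t x) (hm : ∀ t x y, 0 < m t x y) (t : ℕ) (z : Fin N → X) (k : Fin N)
    {f : X → ℝ} (hf : BddMeas f) :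
    ∫ y, S.backW m t z k y * f y ∂(S.mixLaw t z) =
      (S.g t (z k) / ∑ j, S.g t (z j)) * ∫ y, f y ∂(S.M t (z k)) := by
  have hb := bddMeas_backW hg hm hd.measurable_m t z
  have hmy : ∀ x, Measurable (m t x) := fun x => (hd.measurable_m t).comp measurable_prodMk_left
  rw [integral_mixLaw hg t z ((hb k).mul hf)]
  have hM : ∀ (x : X) (φ : X → ℝ), ∫ y, φ y ∂(S.M t x) = ∫ y, m t x y * φ y ∂ν := by
    intro x φ
    rw [hd.M_eq t x, integral_withDensity_eq_integral_toReal_smul (hmy x).ennreal_ofReal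
      (ae_of_all _ fun _ => ENNReal.ofReal_lt_top)]
    simp [ENNReal.toReal_ofReal (hm t x _).le]
  -- `ν` is an arbitrary measure, so integrability is transferred from the probability measure `S.M
  -- t x`.
  have hMi : ∀ (x : X) (φ : X → ℝ), BddMeas φ → Integrable (fun y => m t x y * φ y) ν := by
    intro x φ hφ
    have := hφ.integrable (S.M t x)
    rw [hd.M_eq t x, integrable_withDensity_iff_integrable_smul' (hmy x).ennreal_ofReal
      (ae_of_all _ fun _ => ENNReal.ofReal_lt_top)] at this
    simpa [ENNReal.toReal_ofReal (hm t x _).le] using this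
  simp_rw [hM, ← integral_const_mul]
  rw [← integral_finsetSum _ fun j _ => (hMi _ _ ((hb k).mul hf)).const_mul _]
  refine integral_congr_ae (ae_of_all _ fun y => ?_)
  have hpos : 0 < ∑ j, S.g t (z j) * m t (z j) y :=
    Finset.sum_pos (fun j _ => mul_pos (hg _ _) (hm _ _ _)) ⟨0, Finset.mem_univ _⟩
  have hposg := sum_g_pos hg t z
  simp only
  have h1 : ∀ j, S.g t (z j) / (∑ j, S.g t (z j)) * (m t (z j) y * (S.backW m t z k y * f y)) =
      (S.g t (z j) * m t (z j) y) * (S.backW m t z k y * f y / ∑ j, S.g t (z j)) := fun j => by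
    ring
  simp_rw [h1]
  rw [← Finset.sum_mul]
  unfold backW
  field_simp

end backW

/-- The path of particles stopped at time `t`. -/
def past (t : ℕ) (x : ℕ → Fin N → X) : ℕ → Fin N → X := fun s => x (min s t)

/-! ### Conditional law of the particles given the past. -/

section Step

set_option linter.unusedSectionVars false

variable {Ω : Type*} [MeasurableSpace Ω] {P : Measure Ω} [IsProbabilityMeasure P]
  {ξ : ℕ → Fin N → Ω → X} {A : ℕ → Fin N → Ω → Fin N}

lemma history_le (hpf : S.IsBootstrapFilter P ξ A) (t : ℕ) :
    history ξ A t ≤ (inferInstance : MeasurableSpace Ω) :=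
  sup_le (iSup₂_le fun s _ => iSup_le fun i => (hpf.measurable_ξ s i).comap_le)
    (iSup₂_le fun s _ => iSup_le fun i => (hpf.measurable_A s i).comap_le)

lemma measurable_past_history (t : ℕ) :
    Measurable[history ξ A t] fun ω => past t (fun s i => ξ s i ω) := by
  refine @measurable_pi_lambda _ _ _ (history ξ A t) _ _ fun s => ?_
  refine @measurable_pi_lambda _ _ _ (history ξ A t) _ _ fun i => ?_
  rw [measurable_iff_comap_le]
  refine le_sup_of_le_left ?_
  exact le_iSup₂_of_le (min s t) (min_le_right s t)
    (le_iSup (fun i => MeasurableSpace.comap (ξ (min s t) i) inferInstance) i)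

lemma measurable_path (hpf : S.IsBootstrapFilter P ξ A) :
    Measurable fun ω => (fun s i => ξ s i ω : ℕ → Fin N → X) :=
  measurable_pi_lambda _ fun s => measurable_pi_lambda _ fun i => hpf.measurable_ξ s i

/-- Integrating the conditional probabilities over an event `C` of the history gives an identity of
finite measures, which need only be checked on rectangles. There, summing over all ancestor vectors
turns a sum of products into a product of sums, the product of mixtures. -/
lemma restrict_map_next [NeZero N] (hg : ∀ t x, 0 < S.g t x) (hpf : S.IsBootstrapFilter P ξ A)
    (t : ℕ) {C : Set Ω} (hC : MeasurableSet[history ξ A t] C) :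
    (P.restrict C).map (fun ω i => ξ (t + 1) i ω) =
      (P.restrict C).bind
        (fun ω => Measure.pi fun _ : Fin N => S.mixLaw t (fun i => ξ t i ω)) := by
  have := fun z : Fin N → X => isProbabilityMeasure_mixLaw hg t z
  have hle := history_le hpf t
  have hξ : ∀ s, Measurable fun ω i => ξ s i ω := fun s =>
    measurable_pi_lambda _ fun i => hpf.measurable_ξ s i
  have hκ : Measurable fun ω => Measure.pi fun _ : Fin N => S.mixLaw t (fun i => ξ t i ω) :=
    (measurable_pi_mixLaw hg t).comp (hξ t)
  refine ext_of_generate_finite _ generateFrom_pi.symm isPiSystem_pi ?_ ?_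
  · rintro _ ⟨B, hB, rfl⟩
    have hB : ∀ i, MeasurableSet (B i) := fun i => hB i (Set.mem_univ i)
    rw [Measure.map_apply (hξ _) (MeasurableSet.univ_pi hB),
      Measure.bind_apply (MeasurableSet.univ_pi hB) hκ.aemeasurable]
    simp_rw [Measure.pi_pi, mixLaw_real hg]
    set w : Ω → Fin N → ℝ := fun ω k => S.weight (fun s j => ξ s j ω) t k with hw
    have hw0 : ∀ ω k, 0 ≤ w ω k := fun ω k => div_nonneg (hg _ _).le (sum_g_pos hg t _).le
    have hw1 : ∀ ω k, w ω k ≤ 1 := fun ω k => div_le_one_of_le₀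
      (Finset.single_le_sum (f := fun j => S.g t (ξ t j ω)) (fun j _ => (hg _ _).le)
        (Finset.mem_univ k)) (sum_g_pos hg t _).le
    set E : (Fin N → Fin N) → Set Ω := fun a => {ω | ∀ i, A t i ω = a i ∧ ξ (t + 1) i ω ∈ B i}
      with hE
    have hEm : ∀ a, MeasurableSet (E a) := by
      intro a
      have : E a = ⋂ i, (A t i ⁻¹' {a i} ∩ ξ (t + 1) i ⁻¹' B i) := by
        ext ω; simp [hE]
      rw [this]
      exact MeasurableSet.iInter fun i => (hpf.measurable_A t i (measurableSet_singleton _)).inter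
        (hpf.measurable_ξ (t + 1) i (hB i))
    have hgt := S.measurable_g t
    have hwm : ∀ k, Measurable fun ω => w ω k := by
      intro k
      have := hpf.measurable_ξ t
      simp only [hw, weight]
      fun_prop
    have hMm : ∀ k i, Measurable fun ω => (S.M t (ξ t k ω)).real (B i) := fun k i =>
      (((S.M t).measurable_coe (hB i)).comp (hpf.measurable_ξ t k)).ennreal_toReal
    have hprodB : ∀ a : Fin N → Fin N, BddMeas fun ω =>
        ∏ i, w ω (a i) * (S.M t (ξ t (a i) ω)).real (B i) := by
      intro a
      refine ⟨Finset.measurable_fun_prod _ fun i _ => (hwm _).mul (hMm _ _), 1, fun ω => ?_⟩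
      rw [Finset.abs_prod]
      refine Finset.prod_le_one (fun _ _ => abs_nonneg _) fun i _ => ?_
      rw [abs_of_nonneg (mul_nonneg (hw0 _ _) measureReal_nonneg)]
      exact mul_le_one₀ (hw1 _ _) measureReal_nonneg measureReal_le_one
    have hprod0 : ∀ (a : Fin N → Fin N) ω,
        0 ≤ ∏ i, w ω (a i) * (S.M t (ξ t (a i) ω)).real (B i) := fun a ω =>
      Finset.prod_nonneg fun i _ => mul_nonneg (hw0 _ _) measureReal_nonneg
    have hEa : ∀ a, P (E a ∩ C) =
        ENNReal.ofReal (∫ ω in C, ∏ i, w ω (a i) * (S.M t (ξ t (a i) ω)).real (B i) ∂P) := by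
      intro a
      have h1 := setIntegral_condExp (μ := P) hle
        (f := (E a).indicator fun _ => (1 : ℝ)) ((integrable_const 1).indicator (hEm a)) hC
      rw [setIntegral_congr_ae (hle _ hC) ((hpf.step t a B hB).mono fun ω h _ => h)] at h1
      rw [h1, integral_indicator (hEm a)]
      simp [Measure.restrict_apply (hEm a), measureReal_def]
    -- The ancestors are marginalized by splitting the event over their finitely many joint values.
    have hunion : (fun ω i => ξ (t + 1) i ω) ⁻¹' Set.univ.pi B = ⋃ a, E a := by
      ext ω
      simp only [Set.mem_preimage, Set.mem_pi, Set.mem_univ, true_implies, Set.mem_iUnion, hE,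
        Set.mem_ofPred_eq]
      exact ⟨fun h => ⟨fun i => A t i ω, fun i => ⟨rfl, h i⟩⟩, fun ⟨a, h⟩ i => (h i).2⟩
    have hdisj : Pairwise (Function.onFun Disjoint E) := by
      intro a a' haa
      rw [Function.onFun, Set.disjoint_left]
      intro ω h h'
      exact haa (funext fun i => (h i).1.symm.trans (h' i).1)
    rw [hunion, measure_iUnion hdisj hEm, tsum_fintype]
    simp_rw [Measure.restrict_apply (hEm _), hEa]
    rw [← ENNReal.ofReal_sum_of_nonneg fun a _ => integral_nonneg fun ω => hprod0 a ω,
      ← integral_finsetSum _ fun a _ => (hprodB a).integrable _,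
      ofReal_integral_eq_lintegral_ofReal ((BddMeas.sum _ fun a _ => hprodB a).integrable _)
        (ae_of_all _ fun ω => Finset.sum_nonneg fun a _ => hprod0 a ω)]
    refine lintegral_congr fun ω => ?_
    have hps : ∑ a : Fin N → Fin N, ∏ i, w ω (a i) * (S.M t (ξ t (a i) ω)).real (B i) =
        ∏ i, ∑ k, w ω k * (S.M t (ξ t k ω)).real (B i) := by
      rw [Finset.prod_univ_sum, Fintype.piFinset_univ]
    rw [hps, ENNReal.ofReal_prod_of_nonneg fun i _ => Finset.sum_nonneg fun k _ =>
      mul_nonneg (hw0 ω k) measureReal_nonneg]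
    rfl
  · rw [Measure.map_apply (hξ _) MeasurableSet.univ,
      Measure.bind_apply MeasurableSet.univ hκ.aemeasurable]
    simp

/-- Conditionally on the particles up to time `t`, the next particles are i.i.d. from the
mixture law. -/
lemma lintegral_next [NeZero N] (hg : ∀ t x, 0 < S.g t x) (hpf : S.IsBootstrapFilter P ξ A)
    (t : ℕ) {F : (ℕ → Fin N → X) → (Fin N → X) → ℝ≥0∞} (hF : Measurable (Function.uncurry F))
    (hpast : ∀ x y, F (past t x) y = F x y) :
    ∫⁻ ω, F (fun s i => ξ s i ω) (fun i => ξ (t + 1) i ω) ∂P =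
      ∫⁻ ω, ∫⁻ y, F (fun s i => ξ s i ω) y
        ∂(Measure.pi fun _ : Fin N => S.mixLaw t (fun i => ξ t i ω)) ∂P := by
  have := fun z : Fin N → X => isProbabilityMeasure_mixLaw hg t z
  have hle := history_le hpf t
  have hξ : ∀ s, Measurable fun ω i => ξ s i ω := fun s =>
    measurable_pi_lambda _ fun i => hpf.measurable_ξ s i
  have hpm : Measurable fun ω => past t (fun s i => ξ s i ω) :=
    (measurable_past_history (ξ := ξ) (A := A) t).mono hle le_rfl
  let κ : Kernel (ℕ → Fin N → X) (Fin N → X) :=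
    ⟨fun x => Measure.pi fun _ : Fin N => S.mixLaw t (x t),
      (measurable_pi_mixLaw hg t).comp (measurable_pi_apply t)⟩
  have hκ : ∀ x, κ x = Measure.pi fun _ : Fin N => S.mixLaw t (x t) := fun _ => rfl
  have : IsMarkovKernel κ := ⟨fun x => by rw [hκ]; infer_instance⟩
  -- The path is stopped at `t` to be history-measurable; its coordinate `t`, the only one the
  -- kernel reads, is unchanged.
  have hlaw : P.map (fun ω => (past t (fun s i => ξ s i ω), fun i => ξ (t + 1) i ω)) =
      (P.map fun ω => past t (fun s i => ξ s i ω)) ⊗ₘ κ := by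
    refine Measure.ext_prod fun {s} {u} hs hu => ?_
    have hC : MeasurableSet[history ξ A t] ((fun ω => past t (fun s i => ξ s i ω)) ⁻¹' s) :=
      measurable_past_history (ξ := ξ) (A := A) t hs
    rw [Measure.map_apply (hpm.prodMk (hξ _)) (hs.prod hu), Measure.compProd_apply_prod hs hu,
      setLIntegral_map hs (κ.measurable_coe hu) hpm]
    have h := congrArg (fun μ : Measure (Fin N → X) => μ u) (restrict_map_next hg hpf t hC)
    rw [Measure.map_apply (hξ _) hu, Measure.restrict_apply ((hξ _) hu), Measure.bind_apply hu
      (show AEMeasurable (fun ω => Measure.pi fun _ : Fin N => S.mixLaw t fun i => ξ t i ω) _ from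
        ((measurable_pi_mixLaw hg t).comp (hξ t)).aemeasurable)] at h
    rw [Set.mk_preimage_prod, Set.inter_comm, h]
    refine lintegral_congr fun ω => ?_
    rw [hκ]
    simp only [past, min_self]
  have h1 : ∫⁻ ω, F (fun s i => ξ s i ω) (fun i => ξ (t + 1) i ω) ∂P =
      ∫⁻ p, Function.uncurry F p
        ∂(P.map fun ω => (past t (fun s i => ξ s i ω), fun i => ξ (t + 1) i ω)) := by
    rw [lintegral_map hF (hpm.prodMk (hξ _))]
    exact lintegral_congr fun ω => (hpast _ _).symm
  rw [h1, hlaw, Measure.lintegral_compProd hF, lintegral_map _ hpm]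
  · refine lintegral_congr fun ω => ?_
    simp only [hκ, past, min_self, Function.uncurry]
    exact lintegral_congr fun y => hpast _ _
  · exact hF.lintegral_kernel_prod_right'

end Step

end Model

/-! ### One-step mean-square estimates for the particle system. -/

namespace Model

set_option linter.unusedSectionVars false

variable {X : Type*} [MeasurableSpace X] (S : Model X) {N : ℕ}

/-- The particle approximation of the normalizing constant `γ_t(1)`. -/
def normC (t : ℕ) (x : ℕ → Fin N → X) : ℝ :=
  ∏ s ∈ Finset.range t, ((N : ℝ)⁻¹ * ∑ i, S.g s (x s i))

/-- The quadratic form of the meeting probabilities. -/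
def quadV (m : ℕ → X → X → ℝ) (t : ℕ) (f : X → ℝ) (x : ℕ → Fin N → X) : ℝ :=
  S.normC t x ^ 2 * (N : ℝ)⁻¹ * ∑ i, ∑ j, S.meet m x t i j * (f (x t i) * f (x t j))

/-- The second moment of the row sums of the meeting probabilities. -/
def rowR (m : ℕ → X → X → ℝ) (t : ℕ) (x : ℕ → Fin N → X) : ℝ :=
  S.normC t x ^ 3 * (N : ℝ)⁻¹ * ∑ i, (∑ j, S.meet m x t i j) ^ 2

/-- The action of the unnormalized kernel `Q t` on functions. -/
def opQ (t : ℕ) (f : X → ℝ) (x : X) : ℝ := S.g t x * ∫ y, f y ∂(S.M t x)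

/-- A bound for the mean of `rowR`, uniform in the number of particles. -/
def rowBound (G : ℝ) : ℕ → ℝ
  | 0 => 1
  | t + 1 => 2 * (G ^ (t + 1)) ^ 3 + 4 * G ^ 3 * rowBound G t

lemma rowBound_nonneg {G : ℝ} (hG : 0 ≤ G) (t : ℕ) : 0 ≤ rowBound G t := by
  induction t with
  | zero => exact zero_le_one
  | succ t ih => unfold rowBound; positivity

variable {S} {m : ℕ → X → X → ℝ}

lemma normC_succ (t : ℕ) (x : ℕ → Fin N → X) :
    S.normC (t + 1) x = S.normC t x * ((N : ℝ)⁻¹ * ∑ i, S.g t (x t i)) :=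
  Finset.prod_range_succ _ _

lemma past_self (t : ℕ) (x : ℕ → Fin N → X) : past t x t = x t := by
  simp [past]

lemma normC_past (t : ℕ) (x : ℕ → Fin N → X) : S.normC t (past t x) = S.normC t x :=
  Finset.prod_congr rfl fun s hs => by
    rw [past, min_eq_left (Finset.mem_range.1 hs).le]

lemma normC_succ_past (t : ℕ) (x : ℕ → Fin N → X) :
    S.normC (t + 1) (past t x) = S.normC (t + 1) x := by
  rw [normC_succ, normC_succ, normC_past, past_self]

lemma meet_past (t : ℕ) (x : ℕ → Fin N → X) : S.meet m (past t x) t = S.meet m x t := by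
  funext i j
  exact meet_congr (fun s hs => by rw [past, min_eq_left hs]) i j

lemma measurable_normC (t : ℕ) : Measurable fun x : ℕ → Fin N → X => S.normC t x := by
  have := S.measurable_g
  unfold normC
  fun_prop

lemma measurable_opQ (t : ℕ) {f : X → ℝ} (hf : Measurable f) : Measurable (S.opQ t f) :=
  (S.measurable_g t).mul (hf.stronglyMeasurable.integral_kernel).measurable

lemma measurable_quadV (hm : ∀ t, Measurable (Function.uncurry (m t))) (t : ℕ) {f : X → ℝ}
    (hf : Measurable f) : Measurable fun x : ℕ → Fin N → X => S.quadV m t f x := by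
  have h1 := measurable_normC (S := S) (N := N) t
  have h2 := measurable_meet (S := S) (N := N) hm t
  unfold quadV
  fun_prop

lemma abs_opQ_le {G K : ℝ} (hG : ∀ t x, S.g t x ≤ G) (t : ℕ) {f : X → ℝ}
    (hK : ∀ x, |f x| ≤ K) (x : X) : |S.opQ t f x| ≤ G * K := by
  unfold opQ
  rw [abs_mul, abs_of_nonneg (S.g_nonneg t x)]
  exact mul_le_mul (hG t x) (BddMeas.abs_integral_le hK _) (abs_nonneg _)
    ((S.g_nonneg t x).trans (hG t x))

lemma normC_pos [NeZero N] (hg : ∀ t x, 0 < S.g t x) (t : ℕ) (x : ℕ → Fin N → X) :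
    0 < S.normC t x :=
  Finset.prod_pos fun s _ => mul_pos (inv_pos.2 (Nat.cast_pos.2 (NeZero.pos N)))
    (sum_g_pos hg s (x s))

lemma mean_g_le [NeZero N] {G : ℝ} (hG : ∀ t x, S.g t x ≤ G) (t : ℕ) (z : Fin N → X) :
    (N : ℝ)⁻¹ * ∑ i, S.g t (z i) ≤ G := by
  have hN : (N : ℝ) ≠ 0 := Nat.cast_ne_zero.2 (NeZero.ne N)
  calc (N : ℝ)⁻¹ * ∑ i, S.g t (z i) ≤ (N : ℝ)⁻¹ * ∑ _i : Fin N, G := by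
        gcongr with i; exact hG _ _
    _ = G := by simp [hN]

lemma normC_le [NeZero N] (hg : ∀ t x, 0 < S.g t x) {G : ℝ} (hG : ∀ t x, S.g t x ≤ G) (t : ℕ)
    (x : ℕ → Fin N → X) : S.normC t x ≤ G ^ t := by
  calc S.normC t x ≤ ∏ s ∈ Finset.range t, G := Finset.prod_le_prod
        (fun s _ => mul_nonneg (by positivity) (sum_g_pos hg s (x s)).le)
        fun s _ => mean_g_le hG s (x s)
    _ = G ^ t := by simp

lemma meet_succ_eq (x : ℕ → Fin N → X) (t : ℕ) (i j : Fin N) :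
    S.meet m x (t + 1) i j =
      (if i = j then 1 else 0) + offMix (S.backW m t (x t)) (S.meet m x t) (x (t + 1)) i j := by
  simp only [meet, offMix, mix]
  split_ifs
  · simp
  · rw [zero_add]; rfl

lemma sum_meet_succ (x : ℕ → Fin N → X) (t : ℕ) (i : Fin N) :
    ∑ j, S.meet m x (t + 1) i j =
      1 + ∑ j, offMix (S.backW m t (x t)) (S.meet m x t) (x (t + 1)) i j := by
  simp [meet_succ_eq, Finset.sum_add_distrib]

/-- The bound for the conditional mean of `rowR`. -/
lemma rowR_step_le [NeZero N] (hg : ∀ t x, 0 < S.g t x) (hm : ∀ t x y, 0 < m t x y) {G : ℝ}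
    (hG : ∀ t x, S.g t x ≤ G) (t : ℕ) (x : ℕ → Fin N → X) :
    S.normC (t + 1) x ^ 3 * (N : ℝ)⁻¹ * (2 * N + 2 * N ^ 2 * (∑ k, ∑ l,
        (S.g t (x t k) / ∑ j, S.g t (x t j)) * (S.g t (x t l) / ∑ j, S.g t (x t j)) *
          S.meet m x t k l) +
      2 * N ^ 3 * ∑ k, (S.g t (x t k) / ∑ j, S.g t (x t j)) *
        (∑ l, (S.g t (x t l) / ∑ j, S.g t (x t j)) * S.meet m x t k l) ^ 2) ≤
    2 * (G ^ (t + 1)) ^ 3 + 4 * G ^ 3 * S.rowR m t x := by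
  have hN : (0 : ℝ) < N := Nat.cast_pos.2 (NeZero.pos N)
  have hs := sum_g_pos hg t (x t)
  have hΓ := normC_pos hg t x
  have hG0 : 0 ≤ G := (hg 0 (x 0 0)).le.trans (hG _ _)
  set σ := ∑ j, S.g t (x t j) with hσ
  set Γ := S.normC t x with hΓd
  set E := S.meet m x t with hE
  set γ : Fin N → ℝ := fun k => S.g t (x t k) with hγ
  have hE0 : ∀ k l, 0 ≤ E k l := meet_nonneg hg hm x t
  have hγ0 : ∀ k, 0 ≤ γ k := fun k => (hg _ _).le
  have hγG : ∀ k, γ k ≤ G := fun k => hG _ _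
  -- The diagonal entry makes every row sum at least `1`, so the term linear in row sums is absorbed
  -- into `rowR`.
  have hr1 : ∀ k, ∑ l, E k l ≤ (∑ l, E k l) ^ 2 := by
    intro k
    have : 1 ≤ ∑ l, E k l := by
      rw [← meet_self (S := S) (m := m) x t k]
      exact Finset.single_le_sum (f := fun l => E k l) (fun l _ => hE0 k l) (Finset.mem_univ k)
    nlinarith
  have hr0 : ∀ k, 0 ≤ ∑ l, E k l := fun k => Finset.sum_nonneg fun l _ => hE0 k l
  have hΓ1 : S.normC (t + 1) x = Γ * ((N : ℝ)⁻¹ * σ) := normC_succ t x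
  have hσG : (N : ℝ)⁻¹ * σ ≤ G := mean_g_le hG t (x t)
  have hgE : ∀ k, ∑ l, γ l * E k l ≤ G * ∑ l, E k l := by
    intro k
    rw [Finset.mul_sum]
    gcongr with l _
    · exact hE0 k l
    · exact hγG l
  have hgE0 : ∀ k, 0 ≤ ∑ l, γ l * E k l := fun k =>
    Finset.sum_nonneg fun l _ => mul_nonneg (hγ0 l) (hE0 k l)
  have e2 : ∑ k, ∑ l, (γ k / σ) * (γ l / σ) * E k l =
      (σ⁻¹) ^ 2 * ∑ k, γ k * ∑ l, γ l * E k l := by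
    simp only [Finset.mul_sum]
    refine Finset.sum_congr rfl fun k _ => Finset.sum_congr rfl fun l _ => by ring
  have e3 : ∑ k, (γ k / σ) * (∑ l, (γ l / σ) * E k l) ^ 2 =
      (σ⁻¹) ^ 3 * ∑ k, γ k * (∑ l, γ l * E k l) ^ 2 := by
    rw [Finset.mul_sum]
    refine Finset.sum_congr rfl fun k _ => ?_
    have : ∑ l, (γ l / σ) * E k l = σ⁻¹ * ∑ l, γ l * E k l := by
      rw [Finset.mul_sum]
      exact Finset.sum_congr rfl fun l _ => by ring
    rw [this]; ring
  have b2 : ∑ k, γ k * ∑ l, γ l * E k l ≤ G ^ 2 * ∑ k, (∑ l, E k l) ^ 2 := by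
    rw [Finset.mul_sum]
    refine Finset.sum_le_sum fun k _ => ?_
    calc γ k * ∑ l, γ l * E k l ≤ G * (G * ∑ l, E k l) :=
          mul_le_mul (hγG k) (hgE k) (hgE0 k) hG0
      _ = G ^ 2 * ∑ l, E k l := by ring
      _ ≤ G ^ 2 * (∑ l, E k l) ^ 2 := mul_le_mul_of_nonneg_left (hr1 k) (by positivity)
  have b3 : ∑ k, γ k * (∑ l, γ l * E k l) ^ 2 ≤ G ^ 3 * ∑ k, (∑ l, E k l) ^ 2 := by
    rw [Finset.mul_sum]
    refine Finset.sum_le_sum fun k _ => ?_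
    calc γ k * (∑ l, γ l * E k l) ^ 2 ≤ G * (G * ∑ l, E k l) ^ 2 :=
          mul_le_mul (hγG k) (pow_le_pow_left₀ (hgE0 k) (hgE k) 2) (sq_nonneg _) hG0
      _ = G ^ 3 * (∑ l, E k l) ^ 2 := by ring
  change S.normC (t + 1) x ^ 3 * (N : ℝ)⁻¹ * (2 * N + 2 * N ^ 2 * (∑ k, ∑ l,
      (γ k / σ) * (γ l / σ) * E k l) + 2 * N ^ 3 * ∑ k, (γ k / σ) *
        (∑ l, (γ l / σ) * E k l) ^ 2) ≤ _
  rw [e2, e3]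
  set A2 := ∑ k, γ k * ∑ l, γ l * E k l
  set A3 := ∑ k, γ k * (∑ l, γ l * E k l) ^ 2
  set R := ∑ k, (∑ l, E k l) ^ 2 with hR
  have hR0 : 0 ≤ R := Finset.sum_nonneg fun _ _ => sq_nonneg _
  have hrow : S.rowR m t x = Γ ^ 3 * (N : ℝ)⁻¹ * R := rfl
  -- Three factors `σ` from `normC` absorb the inverse powers up to `σ⁻¹ ^ 3`, so only upper bounds
  -- on the potentials are used.
  have hsplit : S.normC (t + 1) x ^ 3 * (N : ℝ)⁻¹ *
      (2 * N + 2 * N ^ 2 * ((σ⁻¹) ^ 2 * A2) + 2 * N ^ 3 * ((σ⁻¹) ^ 3 * A3)) =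
      2 * S.normC (t + 1) x ^ 3 + 2 * (Γ ^ 3 * (N : ℝ)⁻¹) * (((N : ℝ)⁻¹ * σ) * A2) +
        2 * (Γ ^ 3 * (N : ℝ)⁻¹) * A3 := by
    rw [hΓ1]
    field_simp
  have hΓN : 0 ≤ Γ ^ 3 * (N : ℝ)⁻¹ := by positivity
  rw [hsplit, hrow]
  have c1 : S.normC (t + 1) x ^ 3 ≤ (G ^ (t + 1)) ^ 3 :=
    pow_le_pow_left₀ (normC_pos hg _ _).le (normC_le hg hG _ _) 3
  have c2 : ((N : ℝ)⁻¹ * σ) * A2 ≤ G ^ 3 * R := by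
    calc ((N : ℝ)⁻¹ * σ) * A2 ≤ G * (G ^ 2 * R) := mul_le_mul hσG b2
          (Finset.sum_nonneg fun k _ => mul_nonneg (hγ0 k) (hgE0 k)) hG0
      _ = G ^ 3 * R := by ring
  have d2 := mul_le_mul_of_nonneg_left c2 hΓN
  have d3 := mul_le_mul_of_nonneg_left b3 hΓN
  nlinarith

section Step

variable {Ω : Type*} [MeasurableSpace Ω] {P : Measure Ω} [IsProbabilityMeasure P]
  {ξ : ℕ → Fin N → Ω → X} {A : ℕ → Fin N → Ω → Fin N}

lemma lintegral_next_le [NeZero N] (hg : ∀ t x, 0 < S.g t x) (hpf : S.IsBootstrapFilter P ξ A)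
    (t : ℕ) {F : (ℕ → Fin N → X) → (Fin N → X) → ℝ} (hF : Measurable (Function.uncurry F))
    (hF0 : ∀ x y, 0 ≤ F x y) (hFB : ∀ x, BddMeas (F x))
    (hpast : ∀ x y, F (past t x) y = F x y) {B : (ℕ → Fin N → X) → ℝ}
    (hB : ∀ x, ∫ y, F x y ∂(Measure.pi fun _ : Fin N => S.mixLaw t (x t)) ≤ B x) :
    ∫⁻ ω, ENNReal.ofReal (F (fun s i => ξ s i ω) (fun i => ξ (t + 1) i ω)) ∂P ≤
      ∫⁻ ω, ENNReal.ofReal (B (fun s i => ξ s i ω)) ∂P := by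
  have := fun z : Fin N → X => isProbabilityMeasure_mixLaw hg t z
  rw [lintegral_next hg hpf t (F := fun x y => ENNReal.ofReal (F x y)) hF.ennreal_ofReal
    fun x y => by rw [hpast]]
  refine lintegral_mono fun ω => ?_
  rw [← ofReal_integral_eq_lintegral_ofReal ((hFB _).integrable _) (ae_of_all _ (hF0 _))]
  exact ENNReal.ofReal_le_ofReal (hB fun s i => ξ s i ω)

lemma measurable_offMix_backW (hmm : ∀ t, Measurable (Function.uncurry (m t))) (t : ℕ)
    (i j : Fin N) : Measurable fun p : (ℕ → Fin N → X) × (Fin N → X) =>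
      offMix (S.backW m t (p.1 t)) (S.meet m p.1 t) p.2 i j := by
  unfold offMix mix
  split_ifs
  · exact measurable_const
  · have h1 : ∀ k i, Measurable fun p : (ℕ → Fin N → X) × (Fin N → X) =>
        S.backW m t (p.1 t) k (p.2 i) := by
      intro k i
      have h : Measurable fun p : (ℕ → Fin N → X) × (Fin N → X) => (p.1 t, p.2 i) :=
        ((measurable_pi_apply t).comp measurable_fst).prodMk
          ((measurable_pi_apply i).comp measurable_snd)
      exact (measurable_backW (S := S) hmm t k).comp h
    have h2 : ∀ k l, Measurable fun p : (ℕ → Fin N → X) × (Fin N → X) => S.meet m p.1 t k l :=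
      fun k l => (measurable_meet hmm t k l).comp measurable_fst
    fun_prop

variable {ν : Measure X} {m₀ : X → ℝ}

lemma integral_row_mixLaw_le [NeZero N] (hd : HasDensities S ν m₀ m) (hg : ∀ t x, 0 < S.g t x)
    (hm : ∀ t x y, 0 < m t x y) {G : ℝ} (hG : ∀ t x, S.g t x ≤ G) (t : ℕ) (x : ℕ → Fin N → X) :
    S.normC (t + 1) x ^ 3 * (N : ℝ)⁻¹ * ∫ y, ∑ i, (1 + ∑ j,
        offMix (S.backW m t (x t)) (S.meet m x t) y i j) ^ 2
        ∂(Measure.pi fun _ : Fin N => S.mixLaw t (x t)) ≤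
      2 * (G ^ (t + 1)) ^ 3 + 4 * G ^ 3 * S.rowR m t x := by
  have := fun z : Fin N → X => isProbabilityMeasure_mixLaw hg t z
  have hw : ∀ k, ∫ y, S.backW m t (x t) k y ∂(S.mixLaw t (x t)) =
      S.g t (x t k) / ∑ j, S.g t (x t j) := by
    intro k
    simpa using integral_backW_mul hd hg hm t (x t) k (BddMeas.const 1)
  have h := integral_sum_sq_row_le (S.mixLaw t (x t)) (bddMeas_backW hg hm hd.measurable_m t (x t))
    (backW_nonneg hg hm t (x t)) (backW_sum hg hm t (x t)) (meet_nonneg hg hm x t)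
    (meet_le_one hg hm x t)
  simp only [hw] at h
  refine (mul_le_mul_of_nonneg_left h ?_).trans (rowR_step_le hg hm hG t x)
  have := normC_pos hg (t + 1) x
  positivity

/-- At time `0` the meeting matrix is the identity. Afterwards the conditional mean of `rowR` is an
affine function of its previous value, with coefficients independent of `N`. -/
lemma lintegral_rowR_le [NeZero N] (hd : HasDensities S ν m₀ m) (hg : ∀ t x, 0 < S.g t x)
    (hm : ∀ t x y, 0 < m t x y) {G : ℝ} (hG0 : 0 ≤ G) (hG : ∀ t x, S.g t x ≤ G)
    (hpf : S.IsBootstrapFilter P ξ A) (t : ℕ) :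
    ∫⁻ ω, ENNReal.ofReal (S.rowR m t (fun s i => ξ s i ω)) ∂P ≤
      ENNReal.ofReal (rowBound G t) := by
  have hN : (N : ℝ) ≠ 0 := Nat.cast_ne_zero.2 (NeZero.ne N)
  induction t with
  | zero => simp [rowR, normC, meet, rowBound, hN]
  | succ t ih =>
    have hB := fun (x : ℕ → Fin N → X) i j => bddMeas_offMix (E := S.meet m x t)
      (bddMeas_backW hg hm hd.measurable_m t (x t)) i j
    have h := lintegral_next_le hg hpf t
      (F := fun x y => S.normC (t + 1) x ^ 3 * (N : ℝ)⁻¹ * ∑ i, (1 + ∑ j,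
        offMix (S.backW m t (x t)) (S.meet m x t) y i j) ^ 2)
      (B := fun x => 2 * (G ^ (t + 1)) ^ 3 + 4 * G ^ 3 * S.rowR m t x)
      (by
        have h1 : Measurable fun p : (ℕ → Fin N → X) × (Fin N → X) => S.normC (t + 1) p.1 :=
          (measurable_normC _).comp measurable_fst
        have h2 := measurable_offMix_backW (S := S) (N := N) hd.measurable_m t
        simp only [Function.uncurry_def]
        fun_prop)
      (fun x y => mul_nonneg (mul_nonneg (pow_nonneg (normC_pos hg _ _).le 3) (by positivity))
        (Finset.sum_nonneg fun _ _ => sq_nonneg _))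
      (fun x => (BddMeas.const _).mul (BddMeas.sum _ fun i _ => ((BddMeas.const 1).add
        (BddMeas.sum _ fun j _ => hB x i j)).pow 2))
      (fun x y => by simp only [normC_succ_past, past_self, meet_past])
      (fun x => by
        rw [integral_const_mul]
        exact integral_row_mixLaw_le hd hg hm hG t x)
    have e1 : ∀ ω, S.rowR m (t + 1) (fun s i => ξ s i ω) =
        S.normC (t + 1) (fun s i => ξ s i ω) ^ 3 * (N : ℝ)⁻¹ * ∑ i, (1 + ∑ j,
          offMix (S.backW m t (fun i => ξ t i ω)) (S.meet m (fun s i => ξ s i ω) t)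
            (fun i => ξ (t + 1) i ω) i j) ^ 2 := by
      intro ω
      unfold rowR
      simp only [sum_meet_succ]
    simp_rw [e1]
    refine h.trans ?_
    have hR0 : ∀ x : ℕ → Fin N → X, 0 ≤ S.rowR m t x := fun x =>
      mul_nonneg (mul_nonneg (pow_nonneg (normC_pos hg _ _).le 3) (by positivity))
        (Finset.sum_nonneg fun _ _ => sq_nonneg _)
    simp_rw [fun ω => ENNReal.ofReal_add (p := 2 * (G ^ (t + 1)) ^ 3)
      (q := 4 * G ^ 3 * S.rowR m t (fun s i => ξ s i ω)) (by positivity)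
      (mul_nonneg (by positivity) (hR0 _)),
      fun ω => ENNReal.ofReal_mul (p := 4 * G ^ 3) (q := S.rowR m t (fun s i => ξ s i ω))
        (by positivity)]
    rw [lintegral_add_left measurable_const, lintegral_const_mul' _ _ ENNReal.ofReal_ne_top,
      lintegral_const, measure_univ, mul_one, rowBound, ENNReal.ofReal_add (by positivity)
        (mul_nonneg (by positivity) (rowBound_nonneg hG0 t)),
      ENNReal.ofReal_mul (p := 4 * G ^ 3) (by positivity)]
    gcongr

/-- The difference is a martingale increment: `normC (t + 1)` is known from the past and turns the
mixture mean of `f` into `normC t` times the empirical mean of `opQ t f`. The i.i.d. variance bound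
then applies conditionally. -/
lemma lintegral_mean_sub_le [NeZero N] (hg : ∀ t x, 0 < S.g t x) {G : ℝ}
    (hG : ∀ t x, S.g t x ≤ G) (hpf : S.IsBootstrapFilter P ξ A) (t : ℕ) {f : X → ℝ}
    (hf : Measurable f) {K : ℝ} (hK : ∀ x, |f x| ≤ K) :
    ∫⁻ ω, ENNReal.ofReal ((S.normC (t + 1) (fun s i => ξ s i ω) *
        ((N : ℝ)⁻¹ * ∑ i, f (ξ (t + 1) i ω)) -
      S.normC t (fun s i => ξ s i ω) * ((N : ℝ)⁻¹ * ∑ i, S.opQ t f (ξ t i ω))) ^ 2) ∂P ≤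
      ENNReal.ofReal ((G ^ (t + 1)) ^ 2 * K ^ 2 / N) := by
  have := fun z : Fin N → X => isProbabilityMeasure_mixLaw hg t z
  have hN : (N : ℝ) ≠ 0 := Nat.cast_ne_zero.2 (NeZero.ne N)
  have hfB : BddMeas f := ⟨hf, K, hK⟩
  have hQ := measurable_opQ (S := S) t hf
  have h := lintegral_next_le hg hpf t
    (F := fun x y => (S.normC (t + 1) x * ((N : ℝ)⁻¹ * ∑ i, f (y i)) -
      S.normC t x * ((N : ℝ)⁻¹ * ∑ i, S.opQ t f (x t i))) ^ 2)
    (B := fun _ => (G ^ (t + 1)) ^ 2 * K ^ 2 / N)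
    (by
      have h1 : ∀ t, Measurable fun p : (ℕ → Fin N → X) × (Fin N → X) => S.normC t p.1 :=
        fun t => (measurable_normC _).comp measurable_fst
      simp only [Function.uncurry_def]
      fun_prop)
    (fun x y => sq_nonneg _)
    (fun x => ((((BddMeas.const _).mul ((BddMeas.const _).mul (BddMeas.sum _ fun i _ =>
      hfB.comp (measurable_pi_apply i))))).sub (BddMeas.const _)).pow 2)
    (fun x y => by simp only [normC_succ_past, normC_past, past_self])
    (fun x => by
      have hs := sum_g_pos hg t (x t)
      have e1 : ∀ y : Fin N → X, (S.normC (t + 1) x * ((N : ℝ)⁻¹ * ∑ i, f (y i)) -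
          S.normC t x * ((N : ℝ)⁻¹ * ∑ i, S.opQ t f (x t i))) ^ 2 =
          S.normC (t + 1) x ^ 2 *
            ((N : ℝ)⁻¹ * ∑ i, f (y i) - ∫ y, f y ∂(S.mixLaw t (x t))) ^ 2 := by
        intro y
        rw [← mul_pow, mul_sub, integral_mixLaw hg t (x t) hfB, normC_succ]
        congr 2
        have : ∑ k, S.g t (x t k) / (∑ j, S.g t (x t j)) * ∫ y, f y ∂(S.M t (x t k)) =
            (∑ j, S.g t (x t j))⁻¹ * ∑ k, S.opQ t f (x t k) := by
          rw [Finset.mul_sum]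
          exact Finset.sum_congr rfl fun k _ => by unfold opQ; ring
        rw [this]
        field_simp
      simp_rw [e1]
      rw [integral_const_mul, mul_div_assoc]
      exact mul_le_mul (pow_le_pow_left₀ (normC_pos hg _ _).le (normC_le hg hG _ _) 2)
        (integral_sq_mean_sub_le _ (NeZero.one_le) hf hK) (integral_nonneg fun _ => sq_nonneg _)
        (by positivity))
  simpa using h

/-- The diagonal gives the mean of `f ^ 2` exactly, so the error is that of the off-diagonal
U-statistic. Its `N * (N - 1)` ordered pairs, after normalization, produce the factor `1 - 1/N`. -/
lemma lintegral_quadV_sub_le [NeZero N] (hd : HasDensities S ν m₀ m) (hg : ∀ t x, 0 < S.g t x)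
    (hm : ∀ t x y, 0 < m t x y) {G : ℝ} (hG0 : 0 ≤ G) (hG : ∀ t x, S.g t x ≤ G)
    (hpf : S.IsBootstrapFilter P ξ A) (t : ℕ) {f : X → ℝ}
    (hf : Measurable f) {K : ℝ} (hK : ∀ x, |f x| ≤ K) :
    ∫⁻ ω, ENNReal.ofReal ((S.quadV m (t + 1) f (fun s i => ξ s i ω) -
        (S.normC (t + 1) (fun s i => ξ s i ω) ^ 2 * ((N : ℝ)⁻¹ * ∑ i, f (ξ (t + 1) i ω) ^ 2) +
        (1 - (N : ℝ)⁻¹) * S.quadV m t (S.opQ t f) (fun s i => ξ s i ω))) ^ 2) ∂P ≤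
      ENNReal.ofReal (4 * K ^ 4 * G ^ (t + 1) * rowBound G (t + 1) / N) := by
  have := fun z : Fin N → X => isProbabilityMeasure_mixLaw hg t z
  have hN : (0 : ℝ) < N := Nat.cast_pos.2 (NeZero.pos N)
  have hfB : BddMeas f := ⟨hf, K, hK⟩
  have hQ := measurable_opQ (S := S) t hf
  have hB := fun (x : ℕ → Fin N → X) i j => bddMeas_offMix (E := S.meet m x t)
    (bddMeas_backW hg hm hd.measurable_m t (x t)) i j
  have hq := measurable_quadV (S := S) (N := N) hd.measurable_m t hQ
  have h := lintegral_next_le hg hpf t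
    (F := fun x y => (S.normC (t + 1) x ^ 2 * (N : ℝ)⁻¹ * ∑ i, ∑ j,
        offMix (S.backW m t (x t)) (S.meet m x t) y i j * (f (y i) * f (y j)) -
      (1 - (N : ℝ)⁻¹) * S.quadV m t (S.opQ t f) x) ^ 2)
    (B := fun x => 4 * K ^ 4 * G ^ (t + 1) / N *
      (2 * (G ^ (t + 1)) ^ 3 + 4 * G ^ 3 * S.rowR m t x))
    (by
      have h1 : Measurable fun p : (ℕ → Fin N → X) × (Fin N → X) => S.normC (t + 1) p.1 :=
        (measurable_normC _).comp measurable_fst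
      have h2 := measurable_offMix_backW (S := S) (N := N) hd.measurable_m t
      have h3 : Measurable fun p : (ℕ → Fin N → X) × (Fin N → X) =>
        S.quadV m t (S.opQ t f) p.1 := hq.comp measurable_fst
      simp only [Function.uncurry_def]
      fun_prop)
    (fun x y => sq_nonneg _)
    (fun x => (((BddMeas.const _).mul (BddMeas.sum _ fun i _ => BddMeas.sum _ fun j _ =>
      (hB x i j).mul ((hfB.comp (measurable_pi_apply i)).mul
        (hfB.comp (measurable_pi_apply j))))).sub (BddMeas.const _)).pow 2)
    (fun x y => by simp only [normC_succ_past, normC_past, past_self, meet_past, quadV])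
    (fun x => by
      have hs := sum_g_pos hg t (x t)
      have e1 : ∀ y : Fin N → X, (S.normC (t + 1) x ^ 2 * (N : ℝ)⁻¹ * ∑ i, ∑ j,
            offMix (S.backW m t (x t)) (S.meet m x t) y i j * (f (y i) * f (y j)) -
          (1 - (N : ℝ)⁻¹) * S.quadV m t (S.opQ t f) x) ^ 2 =
          (S.normC (t + 1) x ^ 2 * (N : ℝ)⁻¹) ^ 2 * (∑ i, ∑ j,
            offMix (S.backW m t (x t)) (S.meet m x t) y i j * (f (y i) * f (y j)) -
            N * (N - 1) * ∑ k, ∑ l, (∫ z, S.backW m t (x t) k z * f z ∂(S.mixLaw t (x t))) *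
              (∫ z, S.backW m t (x t) l z * f z ∂(S.mixLaw t (x t))) * S.meet m x t k l) ^ 2 := by
        intro y
        rw [← mul_pow, mul_sub]
        congr 2
        simp_rw [integral_backW_mul hd hg hm t (x t) _ hfB]
        have : ∑ k, ∑ l, S.g t (x t k) / (∑ j, S.g t (x t j)) * (∫ y, f y ∂(S.M t (x t k))) *
            (S.g t (x t l) / (∑ j, S.g t (x t j)) * ∫ y, f y ∂(S.M t (x t l))) *
              S.meet m x t k l = ((∑ j, S.g t (x t j))⁻¹) ^ 2 *
            ∑ k, ∑ l, S.meet m x t k l * (S.opQ t f (x t k) * S.opQ t f (x t l)) := by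
          simp only [Finset.mul_sum]
          exact Finset.sum_congr rfl fun k _ => Finset.sum_congr rfl fun l _ => by
            unfold opQ; ring
        rw [this, normC_succ, quadV]
        field_simp
      simp_rw [e1]
      rw [integral_const_mul]
      have hΓ := normC_pos hg (t + 1) x
      have hΓG := normC_le hg hG (t + 1) x
      have hu := integral_sq_ustat_sub_le (S.mixLaw t (x t))
        (bddMeas_backW hg hm hd.measurable_m t (x t)) (backW_nonneg hg hm t (x t))
        (meet_nonneg hg hm x t) (meet_symm x t) hf hK
      refine (mul_le_mul_of_nonneg_left hu (by positivity)).trans ?_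
      have hrow := integral_row_mixLaw_le hd hg hm hG t x
      set I := ∫ y, ∑ i, (1 + ∑ j, offMix (S.backW m t (x t)) (S.meet m x t) y i j) ^ 2
        ∂(Measure.pi fun _ : Fin N => S.mixLaw t (x t))
      have hI : 0 ≤ I := integral_nonneg fun _ => Finset.sum_nonneg fun _ _ => sq_nonneg _
      -- Of the four factors `normC`, three go with the row estimate and one is bounded by `G ^ (t +
      -- 1)`; one `N⁻¹` is left as the rate.
      calc (S.normC (t + 1) x ^ 2 * (N : ℝ)⁻¹) ^ 2 * (4 * K ^ 4 * I)
          = (4 * K ^ 4 * S.normC (t + 1) x / N) * (S.normC (t + 1) x ^ 3 * (N : ℝ)⁻¹ * I) := by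
            field_simp
        _ ≤ _ := mul_le_mul (by gcongr) hrow (by positivity) (by positivity))
  have e2 : ∀ ω, S.quadV m (t + 1) f (fun s i => ξ s i ω) -
        (S.normC (t + 1) (fun s i => ξ s i ω) ^ 2 * ((N : ℝ)⁻¹ * ∑ i, f (ξ (t + 1) i ω) ^ 2) +
        (1 - (N : ℝ)⁻¹) * S.quadV m t (S.opQ t f) (fun s i => ξ s i ω)) =
      S.normC (t + 1) (fun s i => ξ s i ω) ^ 2 * (N : ℝ)⁻¹ * ∑ i, ∑ j,
        offMix (S.backW m t (fun i => ξ t i ω)) (S.meet m (fun s i => ξ s i ω) t)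
          (fun i => ξ (t + 1) i ω) i j * (f (ξ (t + 1) i ω) * f (ξ (t + 1) j ω)) -
      (1 - (N : ℝ)⁻¹) * S.quadV m t (S.opQ t f) (fun s i => ξ s i ω) := by
    intro ω
    rw [quadV]
    simp only [meet_succ_eq, add_mul, Finset.sum_add_distrib, ite_mul, one_mul, zero_mul,
      Finset.sum_ite_eq, Finset.mem_univ, if_true, ← sq]
    ring
  simp_rw [e2]
  refine h.trans ?_
  have hR := lintegral_rowR_le hd hg hm hG0 hG hpf t
  have hR0 : ∀ x : ℕ → Fin N → X, 0 ≤ S.rowR m t x := fun x =>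
    mul_nonneg (mul_nonneg (pow_nonneg (normC_pos hg _ _).le 3) (by positivity))
      (Finset.sum_nonneg fun _ _ => sq_nonneg _)
  have hK0 : 0 ≤ 4 * K ^ 4 * G ^ (t + 1) / N := by positivity
  simp_rw [fun ω => ENNReal.ofReal_mul (p := 4 * K ^ 4 * G ^ (t + 1) / N)
    (q := 2 * (G ^ (t + 1)) ^ 3 + 4 * G ^ 3 * S.rowR m t (fun s i => ξ s i ω)) hK0,
    fun ω => ENNReal.ofReal_add (p := 2 * (G ^ (t + 1)) ^ 3)
    (q := 4 * G ^ 3 * S.rowR m t (fun s i => ξ s i ω)) (by positivity)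
    (mul_nonneg (by positivity) (hR0 _)),
    fun ω => ENNReal.ofReal_mul (p := 4 * G ^ 3) (q := S.rowR m t (fun s i => ξ s i ω))
      (by positivity)]
  rw [lintegral_const_mul' _ _ ENNReal.ofReal_ne_top, lintegral_add_left measurable_const,
    lintegral_const_mul' _ _ ENNReal.ofReal_ne_top, lintegral_const, measure_univ, mul_one,
    show 4 * K ^ 4 * G ^ (t + 1) * rowBound G (t + 1) / N =
      4 * K ^ 4 * G ^ (t + 1) / N * rowBound G (t + 1) by ring, ENNReal.ofReal_mul hK0, rowBound,
    ENNReal.ofReal_add (by positivity) (mul_nonneg (by positivity) (rowBound_nonneg hG0 t)),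
    ENNReal.ofReal_mul (p := 4 * G ^ 3) (by positivity)]
  gcongr

lemma lintegral_init_mean_sub_le [NeZero N] (hpf : S.IsBootstrapFilter P ξ A) {f : X → ℝ}
    (hf : Measurable f) {K : ℝ} (hK : ∀ x, |f x| ≤ K) :
    ∫⁻ ω, ENNReal.ofReal (((N : ℝ)⁻¹ * ∑ i, f (ξ 0 i ω) - ∫ x, f x ∂S.M₀) ^ 2) ∂P ≤
      ENNReal.ofReal (K ^ 2 / N) := by
  have hξ : Measurable fun ω i => ξ 0 i ω := measurable_pi_lambda _ fun i => hpf.measurable_ξ 0 i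
  have hfB : BddMeas f := ⟨hf, K, hK⟩
  have h1 := lintegral_map (μ := P) (f := fun y : Fin N → X =>
    ENNReal.ofReal (((N : ℝ)⁻¹ * ∑ i, f (y i) - ∫ x, f x ∂S.M₀) ^ 2)) (by fun_prop) hξ
  rw [← h1, hpf.init, ← ofReal_integral_eq_lintegral_ofReal]
  · exact ENNReal.ofReal_le_ofReal (integral_sq_mean_sub_le _ NeZero.one_le hf hK)
  · exact ((((BddMeas.const _).mul (BddMeas.sum _ fun i _ =>
      hfB.comp (measurable_pi_apply i))).sub (BddMeas.const _)).pow 2).integrable _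
  · exact ae_of_all _ fun _ => sq_nonneg _

end Step

end Model

/-! ### The Feynman–Kac flow and the recursion of the asymptotic variance. -/

namespace Model

variable {X : Type*} [MeasurableSpace X] {S : Model X} {G : ℝ}

lemma measurable_ofReal_g (S : Model X) (t : ℕ) :
    Measurable (Function.uncurry fun (x : X) (_ : X) => ENNReal.ofReal (S.g t x)) :=
  ((S.measurable_g t).comp measurable_fst).ennreal_ofReal

lemma isFiniteKernel_Q (hG : ∀ t x, S.g t x ≤ G) (t : ℕ) : IsFiniteKernel (S.Q t) :=
  Kernel.isFiniteKernel_withDensity_of_bounded _ ENNReal.ofReal_ne_top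
    fun x _ => ENNReal.ofReal_le_ofReal (hG t x)

lemma isFiniteKernel_Qbar (hG : ∀ t x, S.g t x ≤ G) (s t : ℕ) : IsFiniteKernel (S.Qbar s t) := by
  induction t with
  | zero => unfold Qbar; infer_instance
  | succ t ih =>
    have := isFiniteKernel_Q hG t
    unfold Qbar
    split_ifs <;> infer_instance

lemma isFiniteMeasure_gam (hG : ∀ t x, S.g t x ≤ G) (t : ℕ) : IsFiniteMeasure (S.gam t) := by
  induction t with
  | zero => unfold gam; infer_instance
  | succ t ih =>
    have := isFiniteKernel_Q hG t
    unfold gam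
    infer_instance

lemma integral_Q (t : ℕ) (x : X) (f : X → ℝ) : ∫ y, f y ∂(S.Q t x) = S.opQ t f x := by
  unfold Q
  rw [Kernel.withDensity_apply _ (measurable_ofReal_g S t),
    integral_withDensity_eq_integral_toReal_smul measurable_const
      (ae_of_all _ fun _ => ENNReal.ofReal_lt_top)]
  simp only [ENNReal.toReal_ofReal (S.g_nonneg t x), smul_eq_mul, integral_const_mul, opQ]

lemma bddMeas_opQ (hG : ∀ t x, S.g t x ≤ G) (t : ℕ) {f : X → ℝ} (hf : BddMeas f) :
    BddMeas (S.opQ t f) := by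
  obtain ⟨hf, K, hK⟩ := hf
  exact ⟨measurable_opQ t hf, G * K, abs_opQ_le hG t hK⟩

lemma integral_gam_succ (hG : ∀ t x, S.g t x ≤ G) (t : ℕ) {f : X → ℝ} (hf : BddMeas f) :
    ∫ x, f x ∂(S.gam (t + 1)) = ∫ x, S.opQ t f x ∂(S.gam t) := by
  have := isFiniteKernel_Q hG t
  have := isFiniteMeasure_gam hG t
  have h := Kernel.integral_comp (κ := Kernel.const Unit (S.gam t)) (η := S.Q t) (a := ())
    (hf.integrable _)
  rw [Kernel.comp_apply, Kernel.const_apply] at h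
  simp_rw [integral_Q] at h
  exact h

lemma gam_succ_real (hG : ∀ t x, S.g t x ≤ G) (t : ℕ) :
    (S.gam (t + 1)).real Set.univ = ∫ x, S.g t x ∂(S.gam t) := by
  have h := integral_gam_succ hG t (BddMeas.const 1)
  simpa [opQ] using h

lemma bddMeas_g (hG : ∀ t x, S.g t x ≤ G) (t : ℕ) : BddMeas (S.g t) :=
  ⟨S.measurable_g t, G, fun x => by rw [abs_of_nonneg (S.g_nonneg t x)]; exact hG t x⟩

lemma gam_real_pos (hg : ∀ t x, 0 < S.g t x) (hG : ∀ t x, S.g t x ≤ G) (t : ℕ) :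
    0 < (S.gam t).real Set.univ := by
  induction t with
  | zero => simp [gam]
  | succ t ih =>
    have := isFiniteMeasure_gam hG t
    rw [gam_succ_real hG, integral_pos_iff_support_of_nonneg (S.g_nonneg t)
      ((bddMeas_g hG t).integrable _)]
    have : Function.support (S.g t) = Set.univ := by
      ext x; simp [(hg t x).ne']
    rw [this]
    exact (ENNReal.toReal_pos_iff.1 ih).1

/-- The unnormalized asymptotic variance of the particle approximation of `γ_t(f)`. -/
def asymV (S : Model X) (t : ℕ) (f : X → ℝ) : ℝ :=
  ∑ s ∈ Finset.range (t + 1),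
    (S.gam s).real Set.univ * ∫ x, (∫ y, f y ∂(S.Qbar s t x)) ^ 2 ∂(S.gam s)

lemma integral_Qbar_self (t : ℕ) (x : X) {f : X → ℝ} (hf : Measurable f) :
    ∫ y, f y ∂(S.Qbar t t x) = f x := by
  have : S.Qbar t t = Kernel.id := by cases t <;> simp [Qbar]
  rw [this, Kernel.id_apply, integral_dirac' _ _ hf.stronglyMeasurable]

lemma integral_Qbar_succ (hG : ∀ t x, S.g t x ≤ G) {s t : ℕ} (hst : s ≤ t) (x : X) {f : X → ℝ}
    (hf : BddMeas f) :
    ∫ y, f y ∂(S.Qbar s (t + 1) x) = ∫ y, S.opQ t f y ∂(S.Qbar s t x) := by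
  have := isFiniteKernel_Q hG t
  have := isFiniteKernel_Qbar hG s t
  rw [Qbar, if_pos hst, Kernel.integral_comp (hf.integrable _)]
  simp_rw [integral_Q]

lemma asymV_zero {f : X → ℝ} (hf : Measurable f) :
    S.asymV 0 f = ∫ x, f x ^ 2 ∂S.M₀ := by
  simp [asymV, integral_Qbar_self 0 _ hf, gam]

/-- The summand at `s = t + 1` involves the identity kernel; in all the others the last factor of
`Qbar` moves onto `f`. This is the limiting form of the recursion for `quadV`. -/
lemma asymV_succ (hG : ∀ t x, S.g t x ≤ G) (t : ℕ) {f : X → ℝ} (hf : BddMeas f) :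
    S.asymV (t + 1) f = (S.gam (t + 1)).real Set.univ * ∫ x, f x ^ 2 ∂(S.gam (t + 1)) +
      S.asymV t (S.opQ t f) := by
  unfold asymV
  rw [Finset.sum_range_succ, add_comm]
  congr 1
  · simp_rw [integral_Qbar_self (t + 1) _ hf.1]
  · refine Finset.sum_congr rfl fun s hs => ?_
    simp_rw [integral_Qbar_succ hG (Nat.lt_succ_iff.1 (Finset.mem_range.1 hs)) _ hf]

/-! ### Limits in probability as the number of particles grows. -/

section Limits

variable {ν : Measure X} {m₀ : X → ℝ} {m : ℕ → X → X → ℝ}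
  {Ω : ℕ → Type*} [∀ N, MeasurableSpace (Ω N)]
  {P : ∀ N, Measure (Ω N)} [∀ N, IsProbabilityMeasure (P N)]
  {ξ : ∀ N, ℕ → Fin N → Ω N → X} {A : ∀ N, ℕ → Fin N → Ω N → Fin N}

lemma tendsto_mean (hg : ∀ t x, 0 < S.g t x) (hG : ∀ t x, S.g t x ≤ G)
    (hpf : ∀ N, S.IsBootstrapFilter (P N) (ξ N) (A N)) (t : ℕ) {f : X → ℝ} (hf : BddMeas f) :
    TendstoInProbability P (fun N ω => S.normC t (fun s i => ξ N s i ω) *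
      ((N : ℝ)⁻¹ * ∑ i, f (ξ N t i ω))) (∫ x, f x ∂(S.gam t)) := by
  have hmeas : ∀ t {f : X → ℝ}, Measurable f → ∀ N, Measurable fun ω =>
      S.normC t (fun s i => ξ N s i ω) * ((N : ℝ)⁻¹ * ∑ i, f (ξ N t i ω)) := by
    intro t f hf N
    have h1 := (measurable_normC (S := S) (N := N) t).comp (measurable_path (hpf N))
    have h2 := (hpf N).measurable_ξ t
    exact h1.mul (by fun_prop)
  induction t generalizing f with
  | zero =>
    obtain ⟨hfm, K, hK⟩ := hf
    refine (TendstoInProbability.const (P := P) (∫ x, f x ∂S.M₀)).of_lintegral_sq_le (K ^ 2)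
      (Eventually.of_forall fun N => (hmeas 0 hfm N).sub measurable_const) ?_
    filter_upwards [eventually_ge_atTop 1] with N hN
    have : NeZero N := ⟨by omega⟩
    simpa [normC] using lintegral_init_mean_sub_le (hpf N) hfm hK
  | succ t ih =>
    rw [integral_gam_succ hG t hf]
    have hQ := bddMeas_opQ hG t hf
    obtain ⟨hfm, K, hK⟩ := hf
    refine (ih hQ).of_lintegral_sq_le ((G ^ (t + 1)) ^ 2 * K ^ 2)
      (Eventually.of_forall fun N => (hmeas (t + 1) hfm N).sub (hmeas t hQ.1 N)) ?_
    filter_upwards [eventually_ge_atTop 1] with N hN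
    have : NeZero N := ⟨by omega⟩
    exact lintegral_mean_sub_le hg hG (hpf N) t hfm hK

lemma tendsto_normC (hg : ∀ t x, 0 < S.g t x) (hG : ∀ t x, S.g t x ≤ G)
    (hpf : ∀ N, S.IsBootstrapFilter (P N) (ξ N) (A N)) (t : ℕ) :
    TendstoInProbability P (fun N ω => S.normC t (fun s i => ξ N s i ω))
      ((S.gam t).real Set.univ) := by
  have h := tendsto_mean hg hG hpf t (BddMeas.const 1)
  simp only [integral_const, smul_eq_mul, mul_one] at h
  refine h.congr' ?_
  filter_upwards [eventually_ge_atTop 1] with N hN ω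
  have : (N : ℝ) ≠ 0 := Nat.cast_ne_zero.2 (by omega)
  simp [this]

/-- The induction runs over all bounded `f` at once, since a step back in time replaces `f` by `opQ
t f`. -/
lemma tendsto_quadV (hd : HasDensities S ν m₀ m) (hg : ∀ t x, 0 < S.g t x)
    (hm : ∀ t x y, 0 < m t x y) (hG0 : 0 ≤ G) (hG : ∀ t x, S.g t x ≤ G)
    (hpf : ∀ N, S.IsBootstrapFilter (P N) (ξ N) (A N)) (t : ℕ) {f : X → ℝ} (hf : BddMeas f) :
    TendstoInProbability P (fun N ω => S.quadV m t f (fun s i => ξ N s i ω)) (S.asymV t f) := by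
  induction t generalizing f with
  | zero =>
    rw [asymV_zero hf.1]
    have h := tendsto_mean hg hG hpf 0 (hf.pow 2)
    refine h.congr' (Eventually.of_forall fun N ω => ?_)
    simp [quadV, normC, meet, sq]
  | succ t ih =>
    rw [asymV_succ hG t hf]
    have hQ := bddMeas_opQ hG t hf
    have h1 : TendstoInProbability P (fun N ω => S.normC (t + 1) (fun s i => ξ N s i ω) ^ 2 *
        ((N : ℝ)⁻¹ * ∑ i, f (ξ N (t + 1) i ω) ^ 2))
        ((S.gam (t + 1)).real Set.univ * ∫ x, f x ^ 2 ∂(S.gam (t + 1))) :=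
      ((tendsto_normC hg hG hpf (t + 1)).mul
        (tendsto_mean hg hG hpf (t + 1) (hf.pow 2))).congr'
          (Eventually.of_forall fun N ω => by ring)
    have h2 : TendstoInProbability P (fun N _ => 1 - (N : ℝ)⁻¹) 1 := by
      refine TendstoInProbability.of_tendsto ?_
      simpa using (tendsto_inv_atTop_nhds_zero_nat (𝕜 := ℝ)).const_sub 1
    have h3 := h1.add (h2.mul (ih hQ))
    rw [one_mul] at h3
    obtain ⟨hfm, K, hK⟩ := hf
    refine h3.of_lintegral_sq_le (4 * K ^ 4 * G ^ (t + 1) * rowBound G (t + 1)) ?_ ?_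
    · refine Eventually.of_forall fun N => ?_
      have hp := measurable_path (hpf N)
      have hξ := (hpf N).measurable_ξ (t + 1)
      have m1 := (measurable_quadV (S := S) (N := N) hd.measurable_m (t + 1) hfm).comp hp
      have m2 := (measurable_quadV (S := S) (N := N) hd.measurable_m t hQ.1).comp hp
      have m3 := (measurable_normC (S := S) (N := N) (t + 1)).comp hp
      exact m1.sub (((m3.pow_const 2).mul (by fun_prop)).add (m2.const_mul _))
    · filter_upwards [eventually_ge_atTop 1] with N hN
      have : NeZero N := ⟨by omega⟩
      exact lintegral_quadV_sub_le hd hg hm hG0 hG (hpf N) t hfm hK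

/-- Nonnegativity of `meet` allows the perturbation to be bounded entrywise. The bound is pathwise,
so `δ` may be taken random. -/
lemma abs_quadV_sub_le {N : ℕ} (hg : ∀ t x, 0 < S.g t x) (hm : ∀ t x y, 0 < m t x y) (t : ℕ)
    {w u : X → ℝ} {a K : ℝ} (ha : ∀ y, |w y| ≤ a) (hK : ∀ y, |u y| ≤ K) (δ : ℝ)
    (x : ℕ → Fin N → X) :
    |S.quadV m t (fun y => u y - w y * δ) x - S.quadV m t u x| ≤
      (2 * K * a * |δ| + a ^ 2 * δ ^ 2) * S.quadV m t (fun _ => 1) x := by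
  have hc : 0 ≤ S.normC t x ^ 2 * (N : ℝ)⁻¹ := by positivity
  unfold quadV
  rw [← mul_sub, abs_mul, abs_of_nonneg hc, mul_left_comm]
  refine mul_le_mul_of_nonneg_left ?_ hc
  rw [← Finset.sum_sub_distrib, Finset.mul_sum]
  refine (Finset.abs_sum_le_sum_abs _ _).trans (Finset.sum_le_sum fun i _ => ?_)
  rw [← Finset.sum_sub_distrib, Finset.mul_sum]
  refine (Finset.abs_sum_le_sum_abs _ _).trans (Finset.sum_le_sum fun j _ => ?_)
  have hE := meet_nonneg (S := S) hg hm x t i j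
  rw [← mul_sub, abs_mul, abs_of_nonneg hE, mul_one, mul_one, mul_comm _ (S.meet m x t i j)]
  refine mul_le_mul_of_nonneg_left ?_ hE
  have e : (u (x t i) - w (x t i) * δ) * (u (x t j) - w (x t j) * δ) - u (x t i) * u (x t j) =
      -(u (x t i) * w (x t j) * δ) + -(u (x t j) * w (x t i) * δ) +
        w (x t i) * w (x t j) * δ ^ 2 := by ring
  have hK0 : 0 ≤ K := (abs_nonneg _).trans (hK (x t i))
  have ha0 : 0 ≤ a := (abs_nonneg _).trans (ha (x t i))
  have b1 : ∀ p q, |u p * w q * δ| ≤ K * a * |δ| := by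
    intro p q
    rw [abs_mul, abs_mul]
    gcongr
    · exact hK p
    · exact ha q
  have b2 : |w (x t i) * w (x t j) * δ ^ 2| ≤ a * a * δ ^ 2 := by
    rw [abs_mul, abs_mul, abs_of_nonneg (sq_nonneg δ)]
    gcongr <;> apply ha
  rw [e]
  refine (abs_add_three _ _ _).trans ?_
  rw [abs_neg, abs_neg]
  nlinarith [b1 (x t i) (x t j), b1 (x t j) (x t i)]

/-- The law of large numbers for `quadV` holds for fixed functions, whereas the estimators centre at
a random value. Replacing that value by its limit costs a vanishing factor times `quadV` of the
constant `1`, which converges. -/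
lemma tendsto_quadV_centered (hd : HasDensities S ν m₀ m) (hg : ∀ t x, 0 < S.g t x)
    (hm : ∀ t x y, 0 < m t x y) (hG0 : 0 ≤ G) (hG : ∀ t x, S.g t x ≤ G)
    (hpf : ∀ N, S.IsBootstrapFilter (P N) (ξ N) (A N)) (t : ℕ) {w h : X → ℝ} (hw : BddMeas w)
    (hh : BddMeas h) {c : ℝ} {V : ∀ N, Ω N → ℝ} (hV : TendstoInProbability P V c) :
    TendstoInProbability P
      (fun N ω => S.quadV m t (fun y => w y * (h y - V N ω)) (fun s i => ξ N s i ω))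
      (S.asymV t fun y => w y * (h y - c)) := by
  have hu : BddMeas fun y => w y * (h y - c) := hw.mul (hh.sub (BddMeas.const c))
  have h1 := tendsto_quadV hd hg hm hG0 hG hpf t hu
  obtain ⟨-, a, ha⟩ := hw
  obtain ⟨-, K, hK⟩ := hu
  have h2 := TendstoInProbability.map₂ (d := S.asymV t fun _ => 1)
    (F := fun p : ℝ × ℝ => (2 * K * a * |p.1 - c| + a ^ 2 * (p.1 - c) ^ 2) * p.2)
    (by fun_prop) hV (tendsto_quadV hd hg hm hG0 hG hpf t (BddMeas.const 1))
  simp only [sub_self, abs_zero, mul_zero, ne_eq, OfNat.ofNat_ne_zero, not_false_eq_true,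
    zero_pow, add_zero, zero_mul] at h2
  refine h1.of_abs_sub_le h2 (Eventually.of_forall fun N ω => ?_)
  have h3 := abs_quadV_sub_le (S := S) hg hm t ha hK (V N ω - c) (fun s i => ξ N s i ω)
  have e : (fun y => w y * (h y - c) - w y * (V N ω - c)) = fun y => w y * (h y - V N ω) := by
    funext y; ring
  rwa [e] at h3

end Limits

/-! ### The estimators as normalized quadratic forms. -/

section Estimators

variable {m : ℕ → X → X → ℝ} {N : ℕ}

lemma sum_T_mul_mul [NeZero N] (hg : ∀ t x, 0 < S.g t x) (hm : ∀ t x y, 0 < m t x y)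
    (x : ℕ → Fin N → X) (t : ℕ) {d : Fin N → ℝ} (hsum : ∑ i, d i = 0) :
    ∑ i, ∑ j, S.T m x t (fun _ => 0) i j * (d i * d j) =
      -∑ i, ∑ j, S.meet m x t i j * (d i * d j) := by
  simp only [T_eq_one_sub_meet hg hm, sub_mul, one_mul, Finset.sum_sub_distrib]
  rw [← Finset.sum_mul_sum, hsum]
  ring

lemma estEta_eq (hN : 2 ≤ N) (hg : ∀ t x, 0 < S.g t x) (hm : ∀ t x y, 0 < m t x y)
    (x : ℕ → Fin N → X) (t : ℕ) (h : X → ℝ) :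
    S.estEta m x t h = ((N : ℝ) / (N - 1)) ^ (t + 1) *
      (S.quadV m t (fun y => 1 * (h y - S.etaN x t h)) x / S.normC t x ^ 2) := by
  have : NeZero N := ⟨by omega⟩
  have hN0 : (N : ℝ) ≠ 0 := Nat.cast_ne_zero.2 (by omega)
  have hN1 : (N : ℝ) - 1 ≠ 0 := by
    have : (2 : ℝ) ≤ N := by exact_mod_cast hN
    linarith
  have hΓ := (normC_pos hg t x).ne'
  have hsum : ∑ i, (h (x t i) - S.etaN x t h) = 0 := by
    rw [Finset.sum_sub_distrib]
    simp [etaN, hN0]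
  have h1 := sum_T_mul_mul hg hm x t hsum
  unfold estEta quadV
  simp only [one_mul, mul_assoc] at h1 ⊢
  rw [h1, div_pow]
  field_simp
  ring

/-- The centred values weighted by the potential sum to zero by definition of `phiN`. The two weight
denominators equal `N ^ 2 * normC (t + 1) ^ 2 / normC t ^ 2`, which accounts for the additional `N ^
2` in the prefactor relative to `estEta`. -/
lemma estPhi_eq (hN : 2 ≤ N) (hg : ∀ t x, 0 < S.g t x) (hm : ∀ t x y, 0 < m t x y)
    (x : ℕ → Fin N → X) (t : ℕ) (h : X → ℝ) :
    S.estPhi m x t h = ((N : ℝ) / (N - 1)) ^ (t + 1) *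
      (S.quadV m t (fun y => S.g t y * (h y - S.phiN x t h)) x / S.normC (t + 1) x ^ 2) := by
  have : NeZero N := ⟨by omega⟩
  have hN0 : (N : ℝ) ≠ 0 := Nat.cast_ne_zero.2 (by omega)
  have hN1 : (N : ℝ) - 1 ≠ 0 := by
    have : (2 : ℝ) ≤ N := by exact_mod_cast hN
    linarith
  have hΓ := (normC_pos hg t x).ne'
  have hs := (sum_g_pos hg t (x t)).ne'
  have hsum : ∑ i, S.g t (x t i) * (h (x t i) - S.phiN x t h) = 0 := by
    simp only [mul_sub, Finset.sum_sub_distrib, ← Finset.sum_mul]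
    have : S.phiN x t h = (∑ i, S.g t (x t i) * h (x t i)) / ∑ j, S.g t (x t j) := by
      rw [Finset.sum_div]
      exact Finset.sum_congr rfl fun i _ => by unfold weight; ring
    rw [this]
    field_simp
    ring
  have h1 := sum_T_mul_mul hg hm x t hsum
  have h2 : ∑ i, ∑ j, S.weight x t i * S.weight x t j * S.T m x t (fun _ => 0) i j *
      (h (x t i) - S.phiN x t h) * (h (x t j) - S.phiN x t h) =
      ((∑ j, S.g t (x t j))⁻¹) ^ 2 * ∑ i, ∑ j, S.T m x t (fun _ => 0) i j *
        (S.g t (x t i) * (h (x t i) - S.phiN x t h) *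
          (S.g t (x t j) * (h (x t j) - S.phiN x t h))) := by
    simp only [Finset.mul_sum]
    exact Finset.sum_congr rfl fun i _ => Finset.sum_congr rfl fun j _ => by
      unfold weight; ring
  unfold estPhi
  rw [h2, h1, normC_succ, div_pow]
  unfold quadV
  field_simp
  ring

end Estimators

lemma integral_eta (t : ℕ) (h : X → ℝ) :
    ∫ x, h x ∂(S.eta t) = (∫ x, h x ∂(S.gam t)) / (S.gam t).real Set.univ := by
  unfold eta
  rw [integral_smul_measure, ENNReal.toReal_inv, smul_eq_mul, div_eq_inv_mul]
  rfl

lemma integral_phi (hg : ∀ t x, 0 < S.g t x) (hG : ∀ t x, S.g t x ≤ G) (t : ℕ) (h : X → ℝ) :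
    ∫ x, h x ∂(S.phi t) = (∫ x, S.g t x * h x ∂(S.gam t)) / ∫ x, S.g t x ∂(S.gam t) := by
  have := isFiniteMeasure_gam hG t
  have hpos := gam_real_pos hg hG t
  have hη : IsFiniteMeasure (S.eta t) := by
    unfold eta
    exact Measure.smul_finite _ (ENNReal.inv_ne_top.2 (ENNReal.toReal_pos_iff.1 hpos).1.ne')
  have hlin : ∫⁻ x, ENNReal.ofReal (S.g t x) ∂(S.eta t) =
      ENNReal.ofReal (∫ x, S.g t x ∂(S.eta t)) :=
    (ofReal_integral_eq_lintegral_ofReal ((bddMeas_g hG t).integrable _)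
      (ae_of_all _ (S.g_nonneg t))).symm
  unfold phi
  rw [hlin, integral_smul_measure, integral_withDensity_eq_integral_toReal_smul
    (S.measurable_g t).ennreal_ofReal (ae_of_all _ fun _ => ENNReal.ofReal_lt_top),
    ENNReal.toReal_inv, ENNReal.toReal_ofReal (integral_nonneg (S.g_nonneg t))]
  simp only [ENNReal.toReal_ofReal (S.g_nonneg t _), smul_eq_mul]
  rw [integral_eta, integral_eta, ← div_eq_inv_mul, div_div_div_cancel_right₀ hpos.ne']

end Model

end SMCVar

end

theorem mainTheorem8 {X : Type*} [MeasurableSpace X]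
    (S : SMCVar.Model X) (ν : Measure X) (m₀ : X → ℝ) (m : ℕ → X → X → ℝ)
    (hdens : SMCVar.HasDensities S ν m₀ m)
    (hg : ∃ G : ℝ, 0 < G ∧ ∀ t x, 0 < S.g t x ∧ S.g t x ≤ G)
    (hm_pos : ∀ t x' x, 0 < m t x' x)
    (hm_bdd : ∃ σ : ℝ, 0 < σ ∧ ∀ t x' x, m t x' x ≤ σ)
    {Ω : ℕ → Type*} [∀ N, MeasurableSpace (Ω N)]
    (P : ∀ N, Measure (Ω N)) [∀ N, IsProbabilityMeasure (P N)]
    (ξ : ∀ N, ℕ → Fin N → Ω N → X) (A : ∀ N, ℕ → Fin N → Ω N → Fin N)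
    (hpf : ∀ N, S.IsBootstrapFilter (P N) (ξ N) (A N))
    (t : ℕ) (h : X → ℝ) (hh : Measurable h) (hh_bdd : ∃ C : ℝ, ∀ x, |h x| ≤ C) :
    SMCVar.TendstoInProbability P
        (fun N ω => S.estEta m (fun s i => ξ N s i ω) t h) (S.sigmaSqEta t h) ∧
      SMCVar.TendstoInProbability P
        (fun N ω => S.estPhi m (fun s i => ξ N s i ω) t h) (S.sigmaSqPhi t h) := by
  obtain ⟨G, hG0, hgG⟩ := hg
  have hg : ∀ t x, 0 < S.g t x := fun t x => (hgG t x).1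
  have hG : ∀ t x, S.g t x ≤ G := fun t x => (hgG t x).2
  have hhB : SMCVar.BddMeas h := ⟨hh, hh_bdd⟩
  have hgB := SMCVar.Model.bddMeas_g hG t
  have hpos := SMCVar.Model.gam_real_pos hg hG
  have hpos' := hpos (t + 1)
  have hratio : SMCVar.TendstoInProbability P (fun N _ => ((N : ℝ) / (N - 1)) ^ (t + 1)) 1 := by
    refine SMCVar.TendstoInProbability.of_tendsto ?_
    have h1 : Tendsto (fun N : ℕ => (1 - (N : ℝ)⁻¹)⁻¹ ^ (t + 1)) atTop (𝓝 1) := by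
      have h0 : Tendsto (fun N : ℕ => 1 - (N : ℝ)⁻¹) atTop (𝓝 1) := by
        simpa using (tendsto_inv_atTop_nhds_zero_nat (𝕜 := ℝ)).const_sub 1
      simpa using (h0.inv₀ one_ne_zero).pow (t + 1)
    refine h1.congr' ?_
    filter_upwards [eventually_ge_atTop 2] with N hN
    have hN0 : (N : ℝ) ≠ 0 := Nat.cast_ne_zero.2 (by omega)
    rw [← inv_div, sub_div, div_self hN0, one_div]
  have hnorm := SMCVar.Model.tendsto_normC hg hG hpf t
  have hnorm' := SMCVar.Model.tendsto_normC hg hG hpf (t + 1)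
  have hc : SMCVar.TendstoInProbability P
      (fun N ω => S.etaN (fun s i => ξ N s i ω) t h) (∫ x, h x ∂(S.eta t)) := by
    rw [SMCVar.Model.integral_eta]
    refine ((SMCVar.Model.tendsto_mean hg hG hpf t hhB).div hnorm (hpos t).ne').congr' ?_
    filter_upwards [eventually_ge_atTop 1] with N hN ω
    have : NeZero N := ⟨by omega⟩
    rw [mul_div_cancel_left₀ _ (SMCVar.Model.normC_pos hg t _).ne']
    rfl
  have hc' : SMCVar.TendstoInProbability P
      (fun N ω => S.phiN (fun s i => ξ N s i ω) t h) (∫ x, h x ∂(S.phi t)) := by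
    rw [SMCVar.Model.integral_phi hg hG]
    rw [SMCVar.Model.gam_succ_real hG] at hpos'
    -- Both `normC t` and `N⁻¹` cancel in the ratio, leaving the self-normalized mean `phiN`.
    refine ((SMCVar.Model.tendsto_mean hg hG hpf t (hgB.mul hhB)).div
      (SMCVar.Model.tendsto_mean hg hG hpf t hgB) hpos'.ne').congr' ?_
    filter_upwards [eventually_ge_atTop 1] with N hN ω
    have : NeZero N := ⟨by omega⟩
    have hN0 : (N : ℝ)⁻¹ ≠ 0 := inv_ne_zero (Nat.cast_ne_zero.2 (by omega))
    rw [mul_div_mul_left _ _ (SMCVar.Model.normC_pos hg t _).ne', mul_div_mul_left _ _ hN0,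
      Finset.sum_div]
    exact Finset.sum_congr rfl fun i _ => by unfold SMCVar.Model.weight; ring
  constructor
  · have h1 := hratio.mul ((SMCVar.Model.tendsto_quadV_centered hdens hg hm_pos hG0.le hG hpf t
      (SMCVar.BddMeas.const 1) hhB hc).div (hnorm.map (F := fun r => r ^ 2) (by fun_prop))
        (pow_ne_zero 2 (hpos t).ne'))
    have e : 1 * (S.asymV t (fun y => 1 * (h y - ∫ x, h x ∂(S.eta t))) /
        (S.gam t).real Set.univ ^ 2) = S.sigmaSqEta t h := by
      simp only [one_mul, SMCVar.Model.asymV, SMCVar.Model.sigmaSqEta, Finset.sum_div]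
    rw [e] at h1
    refine h1.congr' ?_
    filter_upwards [eventually_ge_atTop 2] with N hN ω
    exact SMCVar.Model.estEta_eq hN hg hm_pos _ t h
  · have h1 := hratio.mul ((SMCVar.Model.tendsto_quadV_centered hdens hg hm_pos hG0.le hG hpf t
      hgB hhB hc').div (hnorm'.map (F := fun r => r ^ 2) (by fun_prop))
        (pow_ne_zero 2 (hpos (t + 1)).ne'))
    have e : 1 * (S.asymV t (fun y => S.g t y * (h y - ∫ x, h x ∂(S.phi t))) /
        (S.gam (t + 1)).real Set.univ ^ 2) = S.sigmaSqPhi t h := by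
      simp only [one_mul, SMCVar.Model.asymV, SMCVar.Model.sigmaSqPhi, Finset.sum_div]
    rw [e] at h1
    refine h1.congr' ?_
    filter_upwards [eventually_ge_atTop 2] with N hN ω
    exact SMCVar.Model.estPhi_eq hN hg hm_pos _ t h
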